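/- For a set $M$ let $[M]^2$ be the set of two-element subsets of $M$. A \emph{switchboard} is a set $M$ together with a strict partial order $<$ on $[M]^2$ such that $\{x,y\}$ and $\{x,z\}$ are incomparable for all distinct $x,y,z\in M$. Switchboards are regarded as structures in the language $L$ with one 4-ary relation symbol, interpreted as "$x\neq y$, $z\neq w$ and $\{x,y\}<\{z,w\}$"; the theory of switchboards is the $L$-theory axiomatizing them. A theory $T'$ is a \emph{model companion} of $T$ if every model of $T$ embeds in a model of $T'$, every model of $T'$ embeds in a model of $T$, and every embedding between models of $T'$ is elementary. Relative to a complete theory $T$, a formula $\phi(x,y)$ (with $x,y$ finite tuples of variables) \emph{has the SOP} (strict order property) if in some model $N$ of $T$ there are tuples $b_0,b_1,b_2,\dots$ with $\phi(N,b_0)\subsetneq\phi(N,b_1)\subsetneq\phi(N,b_2)\subsetneq\cdots$, where $\phi(N,b)=\{a : N\models\phi(a,b)\}$; otherwise it is \emph{NSOP}. The theory $T$ has the SOP if some $L$-formula has the SOP relative to $T$. For a model $M$ of $T$, an $L(M)$-formula, i.e. a formula with parameters from $M$, has the SOP if it has the SOP relative to the complete $L(M)$-theory of $M$ (equivalently,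 the chain exists in some elementary extension of $M$). \textbf{Theorem.} The theory of switchboards has a model companion $T^-$ such that: (1) $T^-$ is complete and $\aleph_0$-categorical; (2) $T^-$ has the SOP; (3) for every model $M$ of $T^-$, every $L(M)$-formula $\phi(x,y)$ with $|y|=1$ (and $x$ a finite tuple of any length) is NSOP. In particular, there is a complete theory with the SOP in which every formula $\phi(x,y)$ with parameters from a model and with $|y|=1$ is NSOP. -/

import Mathlib

open FirstOrder FirstOrder.Language

universe u v w

namespace Switchboards

/-! ### Switchboards -/

/-- The set `[M]²` of two-element subsets of `M`, as unordered pairs off the diagonal. -/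
def Edge (M : Type w) : Type w := {e : Sym2 M // ¬ e.IsDiag}

/-- The edge `{x, y}` for `x ≠ y`. -/
def mkEdge {M : Type w} (x y : M) (h : x ≠ y) : Edge M :=
  ⟨s(x, y), fun hd => h (Sym2.mk_isDiag_iff.mp hd)⟩

/-- A switchboard on `M`: a strict partial order on `[M]²` such that `{x, y}` and `{x, z}` are
incomparable for all distinct `x, y, z`. -/
structure Switchboard (M : Type w) where
  lt : Edge M → Edge M → Prop
  irrefl : ∀ e, ¬ lt e e
  trans : ∀ e f g, lt e f → lt f g → lt e g
  incomparable : ∀ (x y z : M) (hxy : x ≠ y) (hxz : x ≠ z), y ≠ z →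
    ¬ lt (mkEdge x y hxy) (mkEdge x z hxz) ∧ ¬ lt (mkEdge x z hxz) (mkEdge x y hxy)

/-- The relation symbols of the language of switchboards: one 4-ary symbol. -/
inductive SwRel : ℕ → Type
  | lt : SwRel 4

/-- The language of switchboards. -/
def Lsw : FirstOrder.Language.{0, 0} := ⟨fun _ => Empty, SwRel⟩

/-- The 4-ary relation symbol. -/
def ltSymb : Lsw.Relations 4 := SwRel.lt

/-- A switchboard as a first-order structure: `<(x, y, z, w)` means
`x ≠ y ∧ z ≠ w ∧ {x, y} < {z, w}`. -/
@[reducible]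
def Switchboard.toStructure {M : Type w} (S : Switchboard M) : Lsw.Structure M where
  funMap := fun f => nomatch f
  RelMap := fun r v => match r, v with
    | SwRel.lt, v => ∃ (h : v 0 ≠ v 1) (h' : v 2 ≠ v 3),
        S.lt (mkEdge (v 0) (v 1) h) (mkEdge (v 2) (v 3) h')

/-- The atomic formula `<(xᵢ, xⱼ, xₖ, xₗ)`. -/
def ltF {n : ℕ} (i j k l : Fin n) : Lsw.BoundedFormula Empty n :=
  ltSymb.boundedFormula ![&i, &j, &k, &l]

/-- The formula `xᵢ = xⱼ`. -/
def eqF {n : ℕ} (i j : Fin n) : Lsw.BoundedFormula Empty n :=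
  Term.bdEqual (&i) (&j)

/-- The theory of switchboards. The first three axioms say that the symbol is the code of a
relation between edges; the last three say that this relation is irreflexive, transitive and
satisfies the incomparability condition. -/
def switchboardTheory : Lsw.Theory :=
  {∀' ∀' ∀' ∀' (ltF 0 1 2 3 ⟹ (∼(eqF 0 1) ⊓ ∼(eqF 2 3))),
   ∀' ∀' ∀' ∀' (ltF 0 1 2 3 ⟹ ltF 1 0 2 3),
   ∀' ∀' ∀' ∀' (ltF 0 1 2 3 ⟹ ltF 0 1 3 2),
   ∀' ∀' ∼(ltF 0 1 0 1),
   ∀' ∀' ∀' ∀' ∀' ∀' ((ltF 0 1 2 3 ⊓ ltF 2 3 4 5) ⟹ ltF 0 1 4 5),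
   ∀' ∀' ∀' ((∼(eqF 0 1) ⊓ (∼(eqF 0 2) ⊓ ∼(eqF 1 2))) ⟹
      (∼(ltF 0 1 0 2) ⊓ ∼(ltF 0 2 0 1)))}

/-! ### Model completeness and model companions -/

section ModelTheory

variable {L : FirstOrder.Language.{u, v}}

/-- `T` is model complete: every embedding between models of `T` is elementary. -/
def IsModelComplete (T : L.Theory) : Prop :=
  ∀ (M N : Theory.ModelType.{u, v, w} T) (f : M ↪[L] N),
    ∃ g : M ↪ₑ[L] N, g.toEmbedding = f

/-- `T'` is a model companion of `T`: every model of `T` embeds in a model of `T'`, every model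
of `T'` embeds in a model of `T`, and `T'` is model complete. -/
structure IsModelCompanion (T T' : L.Theory) : Prop where
  embeds : ∀ M : Theory.ModelType.{u, v, w} T, ∃ N : Theory.ModelType.{u, v, w} T',
    Nonempty (M ↪[L] N)
  embeds' : ∀ N : Theory.ModelType.{u, v, w} T', ∃ M : Theory.ModelType.{u, v, w} T,
    Nonempty (N ↪[L] M)
  modelComplete : IsModelComplete.{u, v, w} T'

/-! ### The strict order property -/

/-- The set `φ(M, b) = {a | M ⊨ φ(a, b)}`. -/
def solutionSet (M : Type w) [L.Structure M] {m n : ℕ} (φ : L.Formula (Fin m ⊕ Fin n))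
    (b : Fin n → M) : Set (Fin m → M) :=
  {a | φ.Realize (Sum.elim a b)}

/-- The formula `φ(x, y)`, with `|x| = m` and `|y| = n`, has the strict order property relative
to `T`: in some model `M` of `T` there are `b₀, b₁, …` with `φ(M, b₀) ⊊ φ(M, b₁) ⊊ ⋯`. -/
def FormulaHasSOP (T : L.Theory) {m n : ℕ} (φ : L.Formula (Fin m ⊕ Fin n)) : Prop :=
  ∃ (M : Theory.ModelType.{u, v, w} T) (b : ℕ → Fin n → M),
    ∀ i, solutionSet M φ (b i) ⊂ solutionSet M φ (b (i + 1))

/-- `T` has the strict order property: some `L`-formula has it. -/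
def HasSOP (T : L.Theory) : Prop :=
  ∃ (m n : ℕ) (φ : L.Formula (Fin m ⊕ Fin n)), FormulaHasSOP.{u, v, w} T φ

/-- The `L(M)`-formula `φ(x, y)` has the strict order property: it has it relative to the
complete `L(M)`-theory of `M`, i.e. with the chain taken in an elementary extension of `M`
(equivalently, in a monster model containing `M`). -/
def ParamFormulaHasSOP (M : Type w) [L.Structure M] {m n : ℕ}
    (φ : (L[[M]]).Formula (Fin m ⊕ Fin n)) : Prop :=
  FormulaHasSOP.{max u w, v, w} (L.elementaryDiagram M) φ

end ModelTheory

/-- The relation `<(x, y, z, w)` in a structure. -/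
def Rlt {M : Type w} [Lsw.Structure M] (x y z t : M) : Prop :=
  Structure.RelMap ltSymb ![x, y, z, t]

theorem realize_ltF {M : Type w} [Lsw.Structure M] {n : ℕ} (i j k l : Fin n) (v : Empty → M)
    (xs : Fin n → M) : (ltF i j k l).Realize v xs ↔ Rlt (xs i) (xs j) (xs k) (xs l) := by
  rw [ltF, BoundedFormula.realize_rel, Rlt]
  apply iff_of_eq
  congr 1
  funext a
  fin_cases a <;> rfl

theorem realize_eqF {M : Type w} [Lsw.Structure M] {n : ℕ} (i j : Fin n) (v : Empty → M)
    (xs : Fin n → M) : (eqF i j).Realize v xs ↔ xs i = xs j := by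
  rw [eqF, BoundedFormula.realize_bdEqual]
  rfl

/-- The axioms, read in a structure. -/
theorem model_iff_axioms {M : Type w} [Lsw.Structure M] :
    M ⊨ switchboardTheory ↔
      ((∀ x y z t : M, Rlt x y z t → x ≠ y ∧ z ≠ t) ∧
       (∀ x y z t : M, Rlt x y z t → Rlt y x z t) ∧
       (∀ x y z t : M, Rlt x y z t → Rlt x y t z) ∧
       (∀ x y : M, ¬ Rlt x y x y) ∧
       (∀ x y z t p q : M, Rlt x y z t → Rlt z t p q → Rlt x y p q) ∧
       (∀ x y z : M, x ≠ y → x ≠ z → y ≠ z → ¬ Rlt x y x z ∧ ¬ Rlt x z x y)) := by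
  simp only [switchboardTheory, Theory.model_iff, Set.mem_insert_iff, Set.mem_singleton_iff,
    forall_eq_or_imp, forall_eq, Sentence.Realize, Formula.Realize, BoundedFormula.realize_all,
    BoundedFormula.realize_imp, BoundedFormula.realize_inf, BoundedFormula.realize_not,
    realize_ltF, realize_eqF, and_imp]
  exact Iff.rfl

/-- The models of the theory of switchboards are exactly the switchboards. -/
theorem model_switchboardTheory_iff {M : Type w} [inst : Lsw.Structure M] :
    M ⊨ switchboardTheory ↔ ∃ S : Switchboard M, S.toStructure = inst := by
  have key : ∀ S : Switchboard M, S.toStructure = inst ↔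
      ∀ x y z t : M, Rlt x y z t ↔
        ∃ (h : x ≠ y) (h' : z ≠ t), S.lt (mkEdge x y h) (mkEdge z t h') := by
    intro S
    constructor
    · rintro rfl x y z t
      exact Iff.rfl
    · intro h
      ext n r v
      · exact nomatch r
      · cases r
        have hv : v = ![v 0, v 1, v 2, v 3] := by
          funext i; fin_cases i <;> rfl
        have := h (v 0) (v 1) (v 2) (v 3)
        rw [Rlt, ← hv] at this
        exact this.symm
  have mk_comm : ∀ (x y : M) (h : x ≠ y), mkEdge x y h = mkEdge y x h.symm :=
    fun x y h => Subtype.ext Sym2.eq_swap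
  rw [model_iff_axioms]
  constructor
  · rintro ⟨h1, h2, h3, h4, h5, h6⟩
    let lt : Edge M → Edge M → Prop := fun e f =>
      ∃ x y z t, e.1 = s(x, y) ∧ f.1 = s(z, t) ∧ Rlt x y z t
    have lt_iff : ∀ (x y z t : M) (h : x ≠ y) (h' : z ≠ t),
        lt (mkEdge x y h) (mkEdge z t h') ↔ Rlt x y z t := by
      intro x y z t h h'
      constructor
      · rintro ⟨x', y', z', t', he, hf, hR⟩
        rcases Sym2.eq_iff.mp he with ⟨rfl, rfl⟩ | ⟨rfl, rfl⟩ <;>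
        rcases Sym2.eq_iff.mp hf with ⟨rfl, rfl⟩ | ⟨rfl, rfl⟩
        · exact hR
        · exact h3 _ _ _ _ hR
        · exact h2 _ _ _ _ hR
        · exact h2 _ _ _ _ (h3 _ _ _ _ hR)
      · intro hR
        exact ⟨x, y, z, t, rfl, rfl, hR⟩
    have rep : ∀ e : Edge M, ∃ (x y : M) (h : x ≠ y), e = mkEdge x y h := by
      rintro ⟨e, he⟩
      induction e using Sym2.ind with
      | _ x y => exact ⟨x, y, fun h => he (Sym2.mk_isDiag_iff.mpr h), rfl⟩
    refine ⟨⟨lt, ?_, ?_, ?_⟩, ?_⟩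
    · intro e
      obtain ⟨x, y, h, rfl⟩ := rep e
      rw [lt_iff]
      exact h4 x y
    · intro e f g
      obtain ⟨x, y, h, rfl⟩ := rep e
      obtain ⟨z, t, h', rfl⟩ := rep f
      obtain ⟨p, q, h'', rfl⟩ := rep g
      rw [lt_iff, lt_iff, lt_iff]
      exact h5 _ _ _ _ _ _
    · intro x y z hxy hxz hyz
      rw [lt_iff, lt_iff]
      exact h6 x y z hxy hxz hyz
    · rw [key]
      intro x y z t
      constructor
      · intro hR
        exact ⟨(h1 _ _ _ _ hR).1, (h1 _ _ _ _ hR).2, (lt_iff _ _ _ _ _ _).mpr hR⟩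
      · rintro ⟨h, h', hR⟩
        exact (lt_iff _ _ _ _ _ _).mp hR
  · rintro ⟨S, hS⟩
    rw [key] at hS
    simp only [hS]
    refine ⟨?_, ?_, ?_, ?_, ?_, ?_⟩
    · rintro x y z t ⟨h, h', -⟩
      exact ⟨h, h'⟩
    · rintro x y z t ⟨h, h', hl⟩
      exact ⟨h.symm, h', mk_comm x y h ▸ hl⟩
    · rintro x y z t ⟨h, h', hl⟩
      exact ⟨h, h'.symm, mk_comm z t h' ▸ hl⟩
    · rintro x y ⟨h, h', hl⟩
      exact S.irrefl _ hl
    · rintro x y z t p q ⟨h, h', hl⟩ ⟨k, k', kl⟩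
      exact ⟨h, k', S.trans _ _ _ hl kl⟩
    · intro x y z hxy hxz hyz
      exact ⟨fun ⟨_, _, hl⟩ => (S.incomparable x y z hxy hxz hyz).1 hl,
        fun ⟨_, _, hl⟩ => (S.incomparable x y z hxy hxz hyz).2 hl⟩

end Switchboards

/-!
The difficulty is that finite switchboards do not amalgamate: if `{a, b} < e` in one of them and
`e < {a, c}` in another, then no common extension exists. The cure is to record, for each vertex
`a`, on which side of `a` each edge avoiding `a` lies: below it, as when `e < {a, c}` for some `c`,
or above it, as when `{a, b} < e` for some `b`. These *sided* switchboards (`Sided`) have free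
amalgamation (`Sided.amalgam`, `Sided.exists_amalgam`): one composes the two orders through the
edges in the common part. Hence every sided switchboard embeds in a generic one, in which every
one-point extension of a finite part is realized (`Sided.exists_isGeneric`).

In a generic sided switchboard the side of an edge is witnessed by an actual edge
(`Sided.IsGeneric.below_iff`, `Sided.IsGeneric.not_below_iff`), so both sides are existentially
definable from the order. The extension axioms can therefore be written in the language of
switchboards; `genericTheory` is the resulting theory. Finite partial isomorphisms of sided
switchboards between generic models go back and forth, so they preserve all formulas
(`exists_finite_realize_iff`). This gives completeness, and also model completeness, because
embeddings of models preserve the two sides; `ℵ₀`-categoricity is the same back and forth along two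
enumerations. The strict order property is witnessed by the order on edges, which is definable by a
formula with two variables on either side.

For a formula `φ(x, y)` with a single variable `y` and parameters in a finite set `C`, strict
inclusion of solution sets is a strict partial order `ψ` on vertices that is invariant under partial
isomorphisms fixing `C`. Given an infinite ascending chain, Ramsey's theorem yields `b₀, b₁, b₂` in
it all of whose increasing pairs have the same type over `C`. Put `d₀ = b₀`, and choose `dₙ₊₁` such
that `(dₙ, dₙ₊₁)` has the type of `(b₀, b₁)` over `C`, and as freely as possible from `d₀`. Then
`ψ d₀ dₙ` holds. A relation that distinguishes `(d₀, dₙ)` from `(dₙ, d₀)` must come from a chain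
of edges `{d₀, c₀} < {d₁, c₁} < ⋯ < {dₙ, cₙ}`, or one in the other direction. The relations
`{b₀, c} < {b₁, c'}` and `{b₁, c} < {b₀, c'}` are strict partial orders on the finite set `C`, so no
such chain exists when `n` is large (`Sided.Far.exists_succ`, `Sided.Far.swap`). Then `(d₀, dₙ)` and
`(dₙ, d₀)` have the same type over `C`, hence `ψ dₙ d₀`, a contradiction
(`Sided.IsGeneric.not_chain`).
-/

namespace Switchboards

/-! ### Sided switchboards -/

/-- A switchboard on `M` in which every vertex `a` splits the edges avoiding `a` into those that
are *below* `a` (to be thought of as `e < {a, c}` for some `c`) and the remaining ones, *above* `a`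
(to be thought of as `{a, b} < e` for some `b`).

Edges are encoded as elements of `Sym2 M`; both relations hold of off-diagonal elements only. The
last axiom says that the edges below `a` form a down-set and the edges above `a` an up-set.
Irreflexivity and the incomparability condition are consequences of it. -/
@[ext]
structure Sided (M : Type*) where
  lt : Sym2 M → Sym2 M → Prop
  below : M → Sym2 M → Prop
  trans {e f g : Sym2 M} : lt e f → lt f g → lt e g
  lt_right {e f : Sym2 M} : lt e f → ¬ f.IsDiag
  below_edge {a : M} {e : Sym2 M} : below a e → ¬ e.IsDiag
  below_notMem {a : M} {e : Sym2 M} : below a e → a ∉ e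
  below_of_lt {a : M} {e f : Sym2 M} : lt e f → a ∈ f ∨ below a f → below a e

namespace Sided

variable {M N V W U : Type*}

theorem lt_left (S : Sided M) {e f : Sym2 M} (h : S.lt e f) : ¬ e.IsDiag := by
  induction f using Sym2.ind with
  | _ x y => exact S.below_edge (S.below_of_lt h (Or.inl (Sym2.mem_mk_left x y)))

/-- Two comparable edges have no common vertex. -/
theorem lt_disjoint (S : Sided M) {e f : Sym2 M} (h : S.lt e f) {a : M} (he : a ∈ e) : a ∉ f :=
  fun hf => S.below_notMem (S.below_of_lt h (Or.inl hf)) he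

theorem lt_irrefl (S : Sided M) (e : Sym2 M) : ¬ S.lt e e := by
  intro h
  induction e using Sym2.ind with
  | _ x y => exact S.lt_disjoint h (Sym2.mem_mk_left x y) (Sym2.mem_mk_left x y)

/-- The pullback of a sided switchboard along an arbitrary map. -/
@[simps]
def comap (f : N → M) (S : Sided M) : Sided N where
  lt e e' := S.lt (e.map f) (e'.map f)
  below a e := S.below (f a) (e.map f)
  trans h h' := S.trans h h'
  lt_right {e e'} h hd := by
    induction e' using Sym2.ind with
    | _ x y => exact S.lt_right h (by simp_all)
  below_edge {a e} h hd := by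
    induction e using Sym2.ind with
    | _ x y => exact S.below_edge h (by simp_all)
  below_notMem h ha := S.below_notMem h (Sym2.mem_map.2 ⟨_, ha, rfl⟩)
  below_of_lt h h' := S.below_of_lt h (h'.imp_left fun ha => Sym2.mem_map.2 ⟨_, ha, rfl⟩)

/-- All vertices of `e` lie in `s`. -/
def Within (e : Sym2 V) (s : Set V) : Prop := ∀ v ∈ e, v ∈ s

@[simp] theorem within_mk {x y : V} {s : Set V} : Within s(x, y) s ↔ x ∈ s ∧ y ∈ s := by
  simp [Within]

theorem Within.mono {e : Sym2 V} {s t : Set V} (h : Within e s) (hst : s ⊆ t) : Within e t :=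
  fun v hv => hst (h v hv)

/-- The relations of `S` hold between vertices in `s` only. -/
structure SupportedOn (S : Sided V) (s : Set V) : Prop where
  lt_l {e f : Sym2 V} : S.lt e f → Within e s
  lt_r {e f : Sym2 V} : S.lt e f → Within f s
  below_l {a : V} {e : Sym2 V} : S.below a e → a ∈ s
  below_r {a : V} {e : Sym2 V} : S.below a e → Within e s

/-- On vertices in `s`, the relations of `S'` imply those of `S`. -/
structure LeOn (S' S : Sided V) (s : Set V) : Prop where
  lt {e f : Sym2 V} : Within e s → Within f s → S'.lt e f → S.lt e f
  below {a : V} {e : Sym2 V} : a ∈ s → Within e s → S'.below a e → S.below a e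

/-- The pushforward of a sided switchboard along an injective map; new vertices are in no
relation. -/
@[simps]
def map (f : N → M) (hf : f.Injective) (S : Sided N) : Sided M where
  lt e e' := ∃ e₀ e₀', S.lt e₀ e₀' ∧ e₀.map f = e ∧ e₀'.map f = e'
  below a e := ∃ a₀ e₀, S.below a₀ e₀ ∧ f a₀ = a ∧ e₀.map f = e
  trans := by
    rintro _ _ _ ⟨e, e', h, rfl, rfl⟩ ⟨g, g', h', hg, rfl⟩
    obtain rfl := Sym2.map.injective hf hg
    exact ⟨_, _, S.trans h h', rfl, rfl⟩
  lt_right := by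
    rintro _ _ ⟨e, e', h, rfl, rfl⟩
    rw [Sym2.isDiag_map hf]
    exact S.lt_right h
  below_edge := by
    rintro _ _ ⟨a, e, h, rfl, rfl⟩
    rw [Sym2.isDiag_map hf]
    exact S.below_edge h
  below_notMem := by
    rintro _ _ ⟨a, e, h, rfl, rfl⟩ ha
    obtain ⟨b, hb, hab⟩ := Sym2.mem_map.1 ha
    obtain rfl := hf hab
    exact S.below_notMem h hb
  below_of_lt := by
    rintro x _ _ ⟨e, e', h, rfl, rfl⟩ (hx | ⟨a, g, hg, rfl, hge⟩)
    · obtain ⟨b, hb, rfl⟩ := Sym2.mem_map.1 hx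
      exact ⟨b, e, S.below_of_lt h (Or.inl hb), rfl, rfl⟩
    · obtain rfl := Sym2.map.injective hf hge
      exact ⟨a, e, S.below_of_lt h (Or.inr hg), rfl, rfl⟩

theorem comap_comap (f : N → M) (g : M → V) (S : Sided V) :
    (S.comap g).comap f = S.comap (g ∘ f) := by
  ext <;> simp [Sym2.map_map]

theorem comap_map {f : N → M} (hf : f.Injective) (S : Sided N) : (S.map f hf).comap f = S := by
  ext e e'
  · constructor
    · rintro ⟨a, b, h, ha, hb⟩
      rwa [← Sym2.map.injective hf ha, ← Sym2.map.injective hf hb]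
    · exact fun h => ⟨e, e', h, rfl, rfl⟩
  · constructor
    · rintro ⟨a, b, h, ha, hb⟩
      rwa [← hf ha, ← Sym2.map.injective hf hb]
    · exact fun h => ⟨e, e', h, rfl, rfl⟩

theorem within_map_range (f : N → M) (e : Sym2 N) : Within (e.map f) (Set.range f) := by
  intro v hv
  obtain ⟨b, -, rfl⟩ := Sym2.mem_map.1 hv
  exact ⟨b, rfl⟩

theorem within_map {f : N → M} {e : Sym2 N} {s : Set M} :
    Within (e.map f) s ↔ Within e (f ⁻¹' s) := by
  induction e using Sym2.ind with
  | _ x y => simp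

theorem exists_map_of_within_range {f : N → M} {e : Sym2 M} (h : Within e (Set.range f)) :
    ∃ e₀ : Sym2 N, e₀.map f = e := by
  induction e using Sym2.ind with
  | _ x y =>
    obtain ⟨⟨a, rfl⟩, ⟨b, rfl⟩⟩ := within_mk.1 h
    exact ⟨s(a, b), rfl⟩

theorem supportedOn_map (f : N → M) (hf : f.Injective) (S : Sided N) :
    (S.map f hf).SupportedOn (Set.range f) where
  lt_l := by rintro _ _ ⟨e, e', -, rfl, rfl⟩; exact within_map_range f e
  lt_r := by rintro _ _ ⟨e, e', -, rfl, rfl⟩; exact within_map_range f e'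
  below_l := by rintro _ _ ⟨a, e, -, rfl, rfl⟩; exact ⟨a, rfl⟩
  below_r := by rintro _ _ ⟨a, e, -, rfl, rfl⟩; exact within_map_range f e

theorem comap_eq_of_leOn {S S' : Sided V} {s : Set V} (h : LeOn S S' s) (h' : LeOn S' S s)
    {f : W → V} (hf : ∀ w, f w ∈ s) : S.comap f = S'.comap f := by
  have hw : ∀ e : Sym2 W, Within (e.map f) s := fun e => within_map.2 fun v _ => hf v
  ext
  · exact ⟨h.lt (hw _) (hw _), h'.lt (hw _) (hw _)⟩
  · exact ⟨h.below (hf _) (hw _), h'.below (hf _) (hw _)⟩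

theorem leOn_of_comap_eq {S S' : Sided V} {f : W → V} (h : S.comap f = S'.comap f) :
    LeOn S S' (Set.range f) where
  lt := by
    intro e e' he he' hl
    obtain ⟨e, rfl⟩ := exists_map_of_within_range he
    obtain ⟨e', rfl⟩ := exists_map_of_within_range he'
    change (S'.comap f).lt e e'
    rw [← h]; exact hl
  below := by
    rintro _ e ⟨a, rfl⟩ he hl
    obtain ⟨e, rfl⟩ := exists_map_of_within_range he
    change (S'.comap f).below a e
    rw [← h]; exact hl

theorem LeOn.mono {S S' : Sided V} {s t : Set V} (h : LeOn S S' t) (hst : s ⊆ t) : LeOn S S' s where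
  lt he hf := h.lt (he.mono hst) (hf.mono hst)
  below ha he := h.below (hst ha) (he.mono hst)

theorem LeOn.trans {S S' S'' : Sided V} {s : Set V} (h : LeOn S S' s) (h' : LeOn S' S'' s) :
    LeOn S S'' s where
  lt he hf hl := h'.lt he hf (h.lt he hf hl)
  below ha he hl := h'.below ha he (h.below ha he hl)

/-! ### Free amalgamation -/

section Amalgam

variable (S : Bool → Sided V) (s : Bool → Set V)

/-- Two sided switchboards that are supported on `s false` and `s true` and agree on the
intersection have a free amalgam: an edge is below another one if it is so in one of the two, or if
an edge of the intersection lies between them, and an edge is below a vertex of the other side if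
an edge of the intersection witnesses this. -/
def amalgam (hs : ∀ i, (S i).SupportedOn (s i)) (hS : ∀ i j, LeOn (S j) (S i) (s i)) : Sided V where
  lt e f := (∃ i, (S i).lt e f) ∨ ∃ i j g, (S i).lt e g ∧ (S j).lt g f
  below a e := (∃ i, (S i).below a e) ∨ ∃ i j g, (S i).lt e g ∧ (S j).below a g
  trans {e f g} h h' := by
    -- among three consecutive steps, two are in the same sided switchboard, and then all the
    -- edges between them are in its support
    have three : ∀ i j k e f g h, (S i).lt e f → (S j).lt f g → (S k).lt g h →
        ∃ i j g, (S i).lt e g ∧ (S j).lt g h := by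
      intro i j k e f g h h1 h2 h3
      by_cases hij : i = j
      · subst hij
        exact ⟨_, _, _, (S i).trans h1 h2, h3⟩
      by_cases hjk : j = k
      · subst hjk
        exact ⟨_, _, _, h1, (S j).trans h2 h3⟩
      have hik : i = k := by cases i <;> cases j <;> cases k <;> simp_all
      subst hik
      exact ⟨_, _, _, h1, (S i).trans ((hS i j).lt ((hs i).lt_r h1) ((hs i).lt_l h3) h2) h3⟩
    rcases h with ⟨i, h⟩ | ⟨i, j, x, hx, hx'⟩ <;> rcases h' with ⟨k, h'⟩ | ⟨k, l, y, hy, hy'⟩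
    · exact Or.inr ⟨_, _, _, h, h'⟩
    · exact Or.inr (three _ _ _ _ _ _ _ h hy hy')
    · exact Or.inr (three _ _ _ _ _ _ _ hx hx' h')
    · obtain ⟨_, _, _, h1, h2⟩ := three _ _ _ _ _ _ _ hx hx' hy
      exact Or.inr (three _ _ _ _ _ _ _ h1 h2 hy')
  lt_right := by
    rintro e f (⟨i, h⟩ | ⟨i, j, x, hx, hx'⟩)
    · exact (S i).lt_right h
    · exact (S j).lt_right hx'
  below_edge := by
    rintro a e (⟨i, h⟩ | ⟨i, j, x, hx, hx'⟩)
    · exact (S i).below_edge h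
    · exact (S i).lt_left hx
  below_notMem := by
    rintro a e (⟨i, h⟩ | ⟨i, j, x, hx, hx'⟩) ha
    · exact (S i).below_notMem h ha
    · have := (hS i j).below ((hs i).lt_l hx a ha) ((hs i).lt_r hx) hx'
      exact (S i).below_notMem ((S i).below_of_lt hx (Or.inr this)) ha
  below_of_lt := by
    have one : ∀ a i e f, (S i).lt e f →
        a ∈ f ∨ ((∃ i, (S i).below a f) ∨ ∃ i j g, (S i).lt f g ∧ (S j).below a g) →
        (∃ i, (S i).below a e) ∨ ∃ i j g, (S i).lt e g ∧ (S j).below a g := by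
      rintro a i e f h (hf | ⟨j, hj⟩ | ⟨j, k, g, hg, hk⟩)
      · exact Or.inl ⟨i, (S i).below_of_lt h (Or.inl hf)⟩
      · exact Or.inr ⟨_, _, _, h, hj⟩
      · by_cases hij : i = j
        · subst hij
          exact Or.inr ⟨_, _, _, (S i).trans h hg, hk⟩
        by_cases hjk : j = k
        · subst hjk
          exact Or.inr ⟨_, _, _, h, (S j).below_of_lt hg (Or.inr hk)⟩
        have hik : i = k := by cases i <;> cases j <;> cases k <;> simp_all
        subst hik
        have := (hS i j).lt ((hs i).lt_r h) ((hs i).below_r hk) hg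
        exact Or.inr ⟨_, _, _, (S i).trans h this, hk⟩
    rintro a e f (⟨i, h⟩ | ⟨i, j, x, hx, hx'⟩) hf
    · exact one a i e f h hf
    · exact one a i e x hx (Or.inr (one a j x f hx' hf))

variable {S s} (hs : ∀ i, (S i).SupportedOn (s i)) (hS : ∀ i j, LeOn (S j) (S i) (s i))

theorem leOn_amalgam (i : Bool) : LeOn (S i) (amalgam S s hs hS) (s i) where
  lt _ _ h := Or.inl ⟨i, h⟩
  below _ _ h := Or.inl ⟨i, h⟩

theorem amalgam_leOn (i : Bool) : LeOn (amalgam S s hs hS) (S i) (s i) where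
  lt := by
    rintro e f he hf (⟨j, h⟩ | ⟨j, k, g, hg, hg'⟩)
    · exact (hS i j).lt he hf h
    · by_cases hjk : j = k
      · subst hjk
        exact (hS i j).lt he hf ((S j).trans hg hg')
      have hg_i : Within g (s i) := by
        obtain rfl | rfl : i = j ∨ i = k := by cases i <;> cases j <;> cases k <;> simp_all
        · exact (hs i).lt_r hg
        · exact (hs i).lt_l hg'
      exact (S i).trans ((hS i j).lt he hg_i hg) ((hS i k).lt hg_i hf hg')
  below := by
    rintro a e ha he (⟨j, h⟩ | ⟨j, k, g, hg, hg'⟩)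
    · exact (hS i j).below ha he h
    · by_cases hjk : j = k
      · subst hjk
        exact (hS i j).below ha he ((S j).below_of_lt hg (Or.inr hg'))
      have hg_i : Within g (s i) := by
        obtain rfl | rfl : i = j ∨ i = k := by cases i <;> cases j <;> cases k <;> simp_all
        · exact (hs i).lt_r hg
        · exact (hs i).below_r hg'
      exact (S i).below_of_lt ((hS i j).lt he hg_i hg) (Or.inr ((hS i k).below ha hg_i hg'))

theorem supportedOn_amalgam : (amalgam S s hs hS).SupportedOn (⋃ i, s i) where
  lt_l := by
    rintro e f (⟨j, h⟩ | ⟨j, k, g, hg, hg'⟩)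
    · exact ((hs j).lt_l h).mono (Set.subset_iUnion s j)
    · exact ((hs j).lt_l hg).mono (Set.subset_iUnion s j)
  lt_r := by
    rintro e f (⟨j, h⟩ | ⟨j, k, g, hg, hg'⟩)
    · exact ((hs j).lt_r h).mono (Set.subset_iUnion s j)
    · exact ((hs k).lt_r hg').mono (Set.subset_iUnion s k)
  below_l := by
    rintro e f (⟨j, h⟩ | ⟨j, k, g, hg, hg'⟩)
    · exact Set.subset_iUnion s j ((hs j).below_l h)
    · exact Set.subset_iUnion s k ((hs k).below_l hg')
  below_r := by
    rintro e f (⟨j, h⟩ | ⟨j, k, g, hg, hg'⟩)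
    · exact ((hs j).below_r h).mono (Set.subset_iUnion s j)
    · exact ((hs j).lt_l hg).mono (Set.subset_iUnion s j)

end Amalgam

/-- Free amalgamation of `S`, supported on `s`, with a copy of `T` placed along `f`. The last four
clauses record that the amalgam is free: edges between the two sides are in no relation, and every
relation between an edge of one side and an edge or a vertex of the other one is witnessed by an
edge of their intersection. -/
theorem exists_amalgam {S : Sided V} {s : Set V} (hs : S.SupportedOn s) {T : Sided W} {f : W → V}
    (hf : f.Injective) {u : U → W} (hu : s ∩ Set.range f = Set.range (f ∘ u))
    (h : T.comap u = S.comap (f ∘ u)) :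
    ∃ E : Sided V, E.SupportedOn (s ∪ Set.range f) ∧ LeOn S E s ∧ LeOn E S s ∧ E.comap f = T ∧
      (∀ e e', E.lt e e' → (Within e s ∧ Within e' s) ∨
        (Within e (Set.range f) ∧ Within e' (Set.range f)) ∨
        ∃ g, Within g (s ∩ Set.range f) ∧ E.lt e g ∧ E.lt g e') ∧
      (∀ a e, E.below a e → (a ∈ s ∧ Within e s) ∨
        (a ∈ Set.range f ∧ Within e (Set.range f)) ∨
        ∃ g, Within g (s ∩ Set.range f) ∧ E.lt e g ∧ E.below a g) ∧
      (∀ e e', E.lt e e' → (Within e s ∨ Within e (Set.range f)) ∧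
        (Within e' s ∨ Within e' (Set.range f))) ∧
      (∀ a e, E.below a e → Within e s ∨ Within e (Set.range f)) := by
  have hT : (T.map f hf).SupportedOn (Set.range f) := supportedOn_map f hf T
  have heq : (T.map f hf).comap (f ∘ u) = S.comap (f ∘ u) := by
    rw [← comap_comap, comap_map, h]
  have h₁ : LeOn (T.map f hf) S s :=
    { lt := fun he he' hl => (leOn_of_comap_eq heq).lt
        (fun v hv => hu ▸ ⟨he v hv, hT.lt_l hl v hv⟩)
        (fun v hv => hu ▸ ⟨he' v hv, hT.lt_r hl v hv⟩) hl
      below := fun ha he hl => (leOn_of_comap_eq heq).below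
        (hu ▸ ⟨ha, hT.below_l hl⟩) (fun v hv => hu ▸ ⟨he v hv, hT.below_r hl v hv⟩) hl }
  have h₂ : LeOn S (T.map f hf) (Set.range f) :=
    { lt := fun he he' hl => (leOn_of_comap_eq heq.symm).lt
        (fun v hv => hu ▸ ⟨hs.lt_l hl v hv, he v hv⟩)
        (fun v hv => hu ▸ ⟨hs.lt_r hl v hv, he' v hv⟩) hl
      below := fun ha he hl => (leOn_of_comap_eq heq.symm).below
        (hu ▸ ⟨hs.below_l hl, ha⟩) (fun v hv => hu ▸ ⟨hs.below_r hl v hv, he v hv⟩) hl }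
  let S' : Bool → Sided V := fun i => bif i then S else T.map f hf
  let s' : Bool → Set V := fun i => bif i then s else Set.range f
  have hs' : ∀ i, (S' i).SupportedOn (s' i) := by rintro (_ | _); exacts [hT, hs]
  have hrefl : ∀ (S : Sided V) s, LeOn S S s := fun S s => ⟨fun _ _ => id, fun _ _ => id⟩
  have hS' : ∀ i j, LeOn (S' j) (S' i) (s' i) := by
    rintro (_ | _) (_ | _)
    exacts [hrefl _ _, h₂, h₁, hrefl _ _]
  have inter : ∀ {i j g}, i ≠ j → Within g (s' i) → Within g (s' j) →
      Within g (s ∩ Set.range f) := by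
    rintro (_ | _) (_ | _) g hij hi hj v hv
    exacts [(hij rfl).elim, ⟨hj v hv, hi v hv⟩, ⟨hi v hv, hj v hv⟩, (hij rfl).elim]
  refine ⟨amalgam S' s' hs' hS', ?_, leOn_amalgam hs' hS' true, amalgam_leOn hs' hS' true, ?_,
    ?_, ?_, ?_, ?_⟩
  · have := supportedOn_amalgam hs' hS'
    rwa [Set.union_eq_iUnion]
  · rw [comap_eq_of_leOn (amalgam_leOn hs' hS' false) (leOn_amalgam hs' hS' false)
      (f := f) (fun w => ⟨w, rfl⟩)]
    exact comap_map hf T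
  · have base : ∀ i e e', (S' i).lt e e' → (Within e s ∧ Within e' s) ∨
        (Within e (Set.range f) ∧ Within e' (Set.range f)) := by
      rintro (_ | _) e e' h
      exacts [Or.inr ⟨hT.lt_l h, hT.lt_r h⟩, Or.inl ⟨hs.lt_l h, hs.lt_r h⟩]
    rintro e e' (⟨i, hi⟩ | ⟨i, j, g, hg, hg'⟩)
    · exact (base i e e' hi).elim Or.inl fun h => Or.inr (Or.inl h)
    · by_cases hij : i = j
      · subst hij
        exact (base i e e' ((S' i).trans hg hg')).elim Or.inl fun h => Or.inr (Or.inl h)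
      · exact Or.inr (Or.inr ⟨g, inter hij ((hs' i).lt_r hg) ((hs' j).lt_l hg'),
          Or.inl ⟨i, hg⟩, Or.inl ⟨j, hg'⟩⟩)
  · have base : ∀ i a e, (S' i).below a e → (a ∈ s ∧ Within e s) ∨
        (a ∈ Set.range f ∧ Within e (Set.range f)) := by
      rintro (_ | _) e e' h
      exacts [Or.inr ⟨hT.below_l h, hT.below_r h⟩, Or.inl ⟨hs.below_l h, hs.below_r h⟩]
    rintro a e (⟨i, hi⟩ | ⟨i, j, g, hg, hg'⟩)
    · exact (base i a e hi).elim Or.inl fun h => Or.inr (Or.inl h)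
    · by_cases hij : i = j
      · subst hij
        exact (base i a e ((S' i).below_of_lt hg (Or.inr hg'))).elim Or.inl
          fun h => Or.inr (Or.inl h)
      · exact Or.inr (Or.inr ⟨g, inter hij ((hs' i).lt_r hg) ((hs' j).below_r hg'),
          Or.inl ⟨i, hg⟩, Or.inl ⟨j, hg'⟩⟩)
  · have side : ∀ i e, Within e (s' i) → Within e s ∨ Within e (Set.range f) := by
      rintro (_ | _) e he
      exacts [Or.inr he, Or.inl he]
    rintro e e' (⟨i, hi⟩ | ⟨i, j, g, hg, hg'⟩)
    · exact ⟨side i e ((hs' i).lt_l hi), side i e' ((hs' i).lt_r hi)⟩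
    · exact ⟨side i e ((hs' i).lt_l hg), side j e' ((hs' j).lt_r hg')⟩
  · have side : ∀ i e, Within e (s' i) → Within e s ∨ Within e (Set.range f) := by
      rintro (_ | _) e he
      exacts [Or.inr he, Or.inl he]
    rintro a e (⟨i, hi⟩ | ⟨i, j, g, hg, hg'⟩)
    · exact side i e ((hs' i).below_r hi)
    · exact side i e ((hs' i).lt_l hg)

/-! ### Generic sided switchboards -/

/-- The finite tuple `x` extended by one last entry `y`. -/
abbrev append {k : ℕ} (x : Fin k → M) (y : M) : Fin (k + 1) → M := Fin.snoc (α := fun _ => M) x y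

theorem append_comp_castSucc {k : ℕ} (x : Fin k → M) (y : M) : append x y ∘ Fin.castSucc = x := by
  funext i; simp

theorem append_injective {k : ℕ} {x : Fin k → M} {y : M} (hx : x.Injective)
    (hy : y ∉ Set.range x) : (append x y).Injective := by
  intro i j hij
  induction i using Fin.lastCases <;> induction j using Fin.lastCases <;>
    simp only [Fin.snoc_last, Fin.snoc_castSucc] at hij
  · rfl
  · exact (hy ⟨_, hij.symm⟩).elim
  · exact (hy ⟨_, hij⟩).elim
  · rw [hx hij]

theorem range_append {k : ℕ} (x : Fin k → M) (y : M) :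
    Set.range (append x y) = insert y (Set.range x) := by
  ext v
  simp [eq_comm]

/-- Every one-point extension of a finite part of `S` is realized in `S`. -/
def IsGeneric (S : Sided M) : Prop :=
  ∀ (k : ℕ) (T : Sided (Fin (k + 1))) (x : Fin k → M), x.Injective →
    T.comap Fin.castSucc = S.comap x → ∃ y, y ∉ Set.range x ∧ S.comap (append x y) = T

/-- Formal names for the vertices of a generic extension of `M`: the vertices of `M`, and a name
for the solution of each one-point extension problem over finitely many names. -/
inductive Name (M : Type w) : Type w
  | base : M → Name M
  | new : (k : ℕ) → Sided (Fin (k + 1)) → (Fin k → Name M) → Name M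

theorem Name.ne_new {M : Type w} {k : ℕ} {T : Sided (Fin (k + 1))} (x : Fin k → Name M)
    (i : Fin k) : x i ≠ .new k T x := by
  suffices ∀ p : Name M, ∀ k T x, p = .new k T x → ∀ i, x i ≠ p from this _ k T x rfl i
  intro p
  induction p with
  | base m => intro k T x h; cases h
  | new k T x ih =>
    rintro k' T' x' h i hi
    cases h
    exact ih i k T x hi i rfl

/-- An approximation to a generic extension of `S₀`: a set of names with a sided switchboard on it,
extending `S₀`, in which every name is a solution of the problem that it names. -/
structure Stage {M : Type w} (S₀ : Sided M) where
  carrier : Set (Name M)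
  str : Sided (Name M)
  supp : str.SupportedOn carrier
  base_mem (m : M) : .base m ∈ carrier
  base_str : str.comap .base = S₀
  new_mem {k T x} : .new k T x ∈ carrier →
    (∀ i, x i ∈ carrier) ∧ str.comap (append x (.new k T x)) = T

namespace Stage

variable {M : Type w} {S₀ : Sided M}

/-- The stage `B` extends the stage `A`. -/
def Le (A B : Stage S₀) : Prop :=
  A.carrier ⊆ B.carrier ∧ LeOn A.str B.str A.carrier ∧ LeOn B.str A.str A.carrier

theorem Le.refl (A : Stage S₀) : Le A A :=
  ⟨subset_rfl, ⟨fun _ _ => id, fun _ _ => id⟩, ⟨fun _ _ => id, fun _ _ => id⟩⟩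

theorem Le.trans {A B C : Stage S₀} (h : Le A B) (h' : Le B C) : Le A C :=
  ⟨h.1.trans h'.1, h.2.1.trans (h'.2.1.mono h.1), (h'.2.2.mono h.1).trans h.2.2⟩

theorem Le.lt {A B : Stage S₀} (h : Le A B) {e f : Sym2 (Name M)} (hl : A.str.lt e f) :
    B.str.lt e f :=
  h.2.1.lt (A.supp.lt_l hl) (A.supp.lt_r hl) hl

theorem Le.below {A B : Stage S₀} (h : Le A B) {a : Name M} {e : Sym2 (Name M)}
    (hl : A.str.below a e) : B.str.below a e :=
  h.2.1.below (A.supp.below_l hl) (A.supp.below_r hl) hl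

theorem base_injective : Function.Injective (Name.base : M → Name M) := by
  intro a b h
  cases h
  rfl

/-- The stage that has the names of the vertices of `S₀` only. -/
def initial (S₀ : Sided M) : Stage S₀ where
  carrier := Set.range .base
  str := S₀.map .base base_injective
  supp := supportedOn_map _ _ _
  base_mem m := ⟨m, rfl⟩
  base_str := comap_map _ _
  new_mem := by rintro k T x ⟨m, hm⟩; cases hm

theorem directed {c : Set (Stage S₀)} (hc : IsChain Le c) {A B : Stage S₀} (hA : A ∈ c)
    (hB : B ∈ c) : ∃ C ∈ c, Le A C ∧ Le B C := by
  by_cases h : A = B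
  · subst h
    exact ⟨A, hA, Le.refl A, Le.refl A⟩
  · rcases hc hA hB h with h | h
    · exact ⟨B, hB, h, Le.refl B⟩
    · exact ⟨A, hA, Le.refl A, h⟩

/-- The union of a chain of sided switchboards. -/
def chainStr {c : Set (Stage S₀)} (hc : IsChain Le c) : Sided (Name M) where
  lt e f := ∃ A ∈ c, A.str.lt e f
  below a e := ∃ A ∈ c, A.str.below a e
  trans := by
    rintro e f g ⟨A, hA, h⟩ ⟨B, hB, h'⟩
    obtain ⟨C, hC, hAC, hBC⟩ := directed hc hA hB
    exact ⟨C, hC, C.str.trans (hAC.lt h) (hBC.lt h')⟩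
  lt_right := by rintro e f ⟨A, hA, h⟩; exact A.str.lt_right h
  below_edge := by rintro e f ⟨A, hA, h⟩; exact A.str.below_edge h
  below_notMem := by rintro e f ⟨A, hA, h⟩; exact A.str.below_notMem h
  below_of_lt := by
    rintro a e f ⟨A, hA, h⟩ (h' | ⟨B, hB, h'⟩)
    · exact ⟨A, hA, A.str.below_of_lt h (Or.inl h')⟩
    · obtain ⟨C, hC, hAC, hBC⟩ := directed hc hA hB
      exact ⟨C, hC, C.str.below_of_lt (hAC.lt h) (Or.inr (hBC.below h'))⟩

theorem leOn_chainStr {c : Set (Stage S₀)} (hc : IsChain Le c) {A : Stage S₀} (hA : A ∈ c) :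
    LeOn A.str (chainStr hc) A.carrier where
  lt _ _ h := ⟨A, hA, h⟩
  below _ _ h := ⟨A, hA, h⟩

theorem chainStr_leOn {c : Set (Stage S₀)} (hc : IsChain Le c) {A : Stage S₀} (hA : A ∈ c) :
    LeOn (chainStr hc) A.str A.carrier where
  lt := by
    rintro e f he hf ⟨B, hB, h⟩
    obtain ⟨C, -, hAC, hBC⟩ := directed hc hA hB
    exact hAC.2.2.lt he hf (hBC.lt h)
  below := by
    rintro e f he hf ⟨B, hB, h⟩
    obtain ⟨C, -, hAC, hBC⟩ := directed hc hA hB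
    exact hAC.2.2.below he hf (hBC.below h)

theorem forall_append {k : ℕ} {x : Fin k → V} {y : V} {s : Set V} (hx : ∀ i, x i ∈ s)
    (hy : y ∈ s) (i : Fin (k + 1)) : append x y i ∈ s := by
  induction i using Fin.lastCases with
  | last => simpa using hy
  | cast i => simpa using hx i

/-- The union of a nonempty chain of stages. -/
def chainStage {c : Set (Stage S₀)} (hc : IsChain Le c) {A₀ : Stage S₀} (hA₀ : A₀ ∈ c) :
    Stage S₀ where
  carrier := ⋃ A ∈ c, A.carrier
  str := chainStr hc
  supp :=
    { lt_l := by
        rintro e f ⟨A, hA, h⟩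
        exact (A.supp.lt_l h).mono (Set.subset_biUnion_of_mem (u := carrier) hA)
      lt_r := by
        rintro e f ⟨A, hA, h⟩
        exact (A.supp.lt_r h).mono (Set.subset_biUnion_of_mem (u := carrier) hA)
      below_l := by
        rintro e f ⟨A, hA, h⟩
        exact Set.subset_biUnion_of_mem (u := carrier) hA (A.supp.below_l h)
      below_r := by
        rintro e f ⟨A, hA, h⟩
        exact (A.supp.below_r h).mono (Set.subset_biUnion_of_mem (u := carrier) hA) }
  base_mem m := Set.subset_biUnion_of_mem (u := carrier) hA₀ (A₀.base_mem m)
  base_str :=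
    (comap_eq_of_leOn (chainStr_leOn hc hA₀) (leOn_chainStr hc hA₀) A₀.base_mem).trans A₀.base_str
  new_mem := by
    intro k T x h
    obtain ⟨A, hA, h⟩ := Set.mem_iUnion₂.1 h
    obtain ⟨hx, hT⟩ := A.new_mem h
    refine ⟨fun i => Set.subset_biUnion_of_mem (u := carrier) hA (hx i), ?_⟩
    rw [comap_eq_of_leOn (chainStr_leOn hc hA) (leOn_chainStr hc hA) (forall_append hx h), hT]

theorem exists_extend (A : Stage S₀) {k : ℕ} {T : Sided (Fin (k + 1))} {x : Fin k → Name M}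
    (hx : x.Injective) (hxA : ∀ i, x i ∈ A.carrier) (h : T.comap Fin.castSucc = A.str.comap x) :
    ∃ B, Le A B ∧ .new k T x ∈ B.carrier := by
  by_cases hp : .new k T x ∈ A.carrier
  · exact ⟨A, Le.refl A, hp⟩
  set p : Name M := .new k T x with hp_def
  have hpx : p ∉ Set.range x := by rintro ⟨i, hi⟩; exact hp (hi ▸ hxA i)
  have hf := append_injective hx hpx
  have hu : A.carrier ∩ Set.range (append x p) = Set.range (append x p ∘ Fin.castSucc) := by
    rw [append_comp_castSucc, range_append]
    ext v
    constructor
    · rintro ⟨hv, rfl | hv'⟩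
      exacts [(hp hv).elim, hv']
    · rintro ⟨i, rfl⟩
      exact ⟨hxA i, Or.inr ⟨i, rfl⟩⟩
  obtain ⟨E, hE, h1, h2, h3, -⟩ := exists_amalgam A.supp hf hu
    (by rw [append_comp_castSucc]; exact h)
  have hsub : A.carrier ∪ Set.range (append x p) ⊆ insert p A.carrier := by
    rw [range_append]
    rintro v (hv | rfl | ⟨i, rfl⟩)
    exacts [Or.inr hv, Or.inl rfl, Or.inr (hxA i)]
  refine ⟨⟨insert p A.carrier, E, ?_, fun m => Or.inr (A.base_mem m), ?_, ?_⟩,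
    ⟨Set.subset_insert _ _, h1, h2⟩, Or.inl rfl⟩
  · exact ⟨fun h => (hE.lt_l h).mono hsub, fun h => (hE.lt_r h).mono hsub,
      fun h => hsub (hE.below_l h), fun h => (hE.below_r h).mono hsub⟩
  · rw [← A.base_str]
    exact comap_eq_of_leOn h2 h1 A.base_mem
  · rintro k' T' x' (hq | hq)
    · obtain ⟨rfl, hT, hx'⟩ := Name.new.inj hq
      obtain rfl := eq_of_heq hT
      obtain rfl := eq_of_heq hx'
      exact ⟨fun i => Or.inr (hxA i), h3⟩
    · obtain ⟨hx', hT'⟩ := A.new_mem hq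
      exact ⟨fun i => Or.inr (hx' i), by
        rw [comap_eq_of_leOn h2 h1 (forall_append hx' hq), hT']⟩

end Stage

/-- Every sided switchboard embeds in a generic one: a maximal stage is generic. -/
theorem exists_isGeneric {M : Type w} (S : Sided M) :
    ∃ (N : Type w) (S' : Sided N) (f : M → N), f.Injective ∧ S'.comap f = S ∧ S'.IsGeneric := by
  obtain ⟨A, hA⟩ : ∃ A : Stage S, ∀ B, Stage.Le A B → Stage.Le B A := by
    refine exists_maximal_of_chains_bounded (fun c hc => ?_) Stage.Le.trans
    rcases c.eq_empty_or_nonempty with rfl | ⟨A₀, hA₀⟩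
    · exact ⟨Stage.initial S, by simp⟩
    · exact ⟨Stage.chainStage hc hA₀, fun A hA =>
        ⟨Set.subset_biUnion_of_mem (u := Stage.carrier) hA, Stage.leOn_chainStr hc hA,
          Stage.chainStr_leOn hc hA⟩⟩
  refine ⟨A.carrier, A.str.comap Subtype.val, fun m => ⟨.base m, A.base_mem m⟩, ?_, ?_, ?_⟩
  · intro a b h
    exact Stage.base_injective (Subtype.ext_iff.1 h)
  · rw [comap_comap]
    exact A.base_str
  · intro k T x hx h
    rw [comap_comap] at h
    obtain ⟨B, hAB, hB⟩ := A.exists_extend (Subtype.val_injective.comp hx) (fun i => (x i).2) h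
    have hp := (hA B hAB).1 hB
    refine ⟨⟨_, hp⟩, ?_, ?_⟩
    · rintro ⟨i, hi⟩
      exact Name.ne_new (Subtype.val ∘ x) i (Subtype.ext_iff.1 hi)
    · rw [comap_comap]
      have : Subtype.val ∘ append x ⟨_, hp⟩ =
          append (Subtype.val ∘ x) (.new k T (Subtype.val ∘ x)) := by
        funext i
        induction i using Fin.lastCases <;> simp
      rw [this]
      exact (A.new_mem hp).2

/-! ### Partial isomorphisms -/

/-- The pairs in `r` form a partial isomorphism from `S` to `T`. -/
structure PartialIso (S : Sided M) (T : Sided N) (r : Set (M × N)) : Prop where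
  eq {p q : M × N} : p ∈ r → q ∈ r → (p.1 = q.1 ↔ p.2 = q.2)
  lt {p q u v : M × N} : p ∈ r → q ∈ r → u ∈ r → v ∈ r →
    (S.lt s(p.1, q.1) s(u.1, v.1) ↔ T.lt s(p.2, q.2) s(u.2, v.2))
  below {p q u : M × N} : p ∈ r → q ∈ r → u ∈ r →
    (S.below p.1 s(q.1, u.1) ↔ T.below p.2 s(q.2, u.2))

namespace PartialIso

variable {S : Sided M} {T : Sided N} {r r' : Set (M × N)}

theorem mono (h : PartialIso S T r') (hr : r ⊆ r') : PartialIso S T r where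
  eq hp hq := h.eq (hr hp) (hr hq)
  lt hp hq hu hv := h.lt (hr hp) (hr hq) (hr hu) (hr hv)
  below hp hq hu := h.below (hr hp) (hr hq) (hr hu)

theorem symm (h : PartialIso S T r) : PartialIso T S (Prod.swap ⁻¹' r) where
  eq hp hq := (h.eq hp hq).symm
  lt hp hq hu hv := (h.lt hp hq hu hv).symm
  below hp hq hu := (h.below hp hq hu).symm

end PartialIso

theorem comap_eq_comap_iff {S : Sided M} {T : Sided N} {u : W → M} {v : W → N} :
    S.comap u = T.comap v ↔
      (∀ i j k l, S.lt s(u i, u j) s(u k, u l) ↔ T.lt s(v i, v j) s(v k, v l)) ∧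
      ∀ i j k, S.below (u i) s(u j, u k) ↔ T.below (v i) s(v j, v k) := by
  constructor
  · intro h
    refine ⟨fun i j k l => ?_, fun i j k => ?_⟩
    · exact iff_of_eq (congrArg (fun R : Sided W => R.lt s(i, j) s(k, l)) h)
    · exact iff_of_eq (congrArg (fun R : Sided W => R.below i s(j, k)) h)
  · rintro ⟨h1, h2⟩
    ext e f
    · induction e using Sym2.ind
      induction f using Sym2.ind
      exact h1 _ _ _ _
    · induction f using Sym2.ind
      exact h2 _ _ _

theorem partialIso_range {S : Sided M} {T : Sided N} {u : W → M} {v : W → N} :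
    PartialIso S T (Set.range fun i => (u i, v i)) ↔
      (∀ i j, u i = u j ↔ v i = v j) ∧ S.comap u = T.comap v := by
  rw [comap_eq_comap_iff]
  constructor
  · intro h
    exact ⟨fun i j => h.eq ⟨i, rfl⟩ ⟨j, rfl⟩,
      fun i j k l => h.lt ⟨i, rfl⟩ ⟨j, rfl⟩ ⟨k, rfl⟩ ⟨l, rfl⟩,
      fun i j k => h.below ⟨i, rfl⟩ ⟨j, rfl⟩ ⟨k, rfl⟩⟩
  · rintro ⟨h0, h1, h2⟩
    refine ⟨?_, ?_, ?_⟩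
    · rintro _ _ ⟨i, rfl⟩ ⟨j, rfl⟩
      exact h0 i j
    · rintro _ _ _ _ ⟨i, rfl⟩ ⟨j, rfl⟩ ⟨k, rfl⟩ ⟨l, rfl⟩
      exact h1 i j k l
    · rintro _ _ _ ⟨i, rfl⟩ ⟨j, rfl⟩ ⟨k, rfl⟩
      exact h2 i j k

/-- A finite partial isomorphism into a generic sided switchboard extends by any vertex of the
other one. -/
theorem IsGeneric.exists_insert {S : Sided M} (hS : S.IsGeneric) {T : Sided N} {r : Set (M × N)}
    (hr : r.Finite) (h : PartialIso S T r) (n : N) : ∃ m, PartialIso S T (insert (m, n) r) := by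
  by_cases hn : ∃ p ∈ r, p.2 = n
  · obtain ⟨p, hp, rfl⟩ := hn
    exact ⟨p.1, by rwa [Set.insert_eq_of_mem hp]⟩
  push Not at hn
  have := hr.to_subtype
  obtain ⟨k, ⟨e⟩⟩ := Finite.exists_equiv_fin r
  let u : Fin k → M := fun i => (e.symm i).1.1
  let v : Fin k → N := fun i => (e.symm i).1.2
  have hruv : r = Set.range fun i => (u i, v i) := by
    ext p
    constructor
    · intro hp
      exact ⟨e ⟨p, hp⟩, by simp [u, v]⟩
    · rintro ⟨i, rfl⟩
      exact (e.symm i).2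
  rw [hruv, partialIso_range] at h
  have hinj : ∀ i j, u i = u j → v i = v j → i = j := fun i j h1 h2 =>
    e.symm.injective (Subtype.ext (Prod.ext h1 h2))
  have hu : u.Injective := fun i j hij => hinj i j hij ((h.1 i j).1 hij)
  have hv : v.Injective := fun i j hij => hinj i j ((h.1 i j).2 hij) hij
  have hnv : n ∉ Set.range v := by
    rintro ⟨i, hi⟩
    exact hn _ (e.symm i).2 hi
  obtain ⟨y, hy, hyT⟩ := hS k (T.comap (append v n)) u hu
    (by rw [comap_comap, append_comp_castSucc, h.2])
  refine ⟨y, ?_⟩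
  have : insert (y, n) r = Set.range fun i => (append u y i, append v n i) := by
    have : (fun i => (append u y i, append v n i)) = append (fun i => (u i, v i)) (y, n) := by
      funext i
      induction i using Fin.lastCases <;> simp
    rw [this, range_append, hruv]
  rw [this, partialIso_range]
  exact ⟨fun i j => by
    rw [(append_injective hu hy).eq_iff, (append_injective hv hnv).eq_iff], hyT⟩

theorem IsGeneric.exists_insert' {S : Sided M} {T : Sided N} (hT : T.IsGeneric) {r : Set (M × N)}
    (hr : r.Finite) (h : PartialIso S T r) (m : M) : ∃ n, PartialIso S T (insert (m, n) r) := by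
  obtain ⟨n, hn⟩ := hT.exists_insert (hr.preimage Prod.swap_injective.injOn) h.symm m
  refine ⟨n, hn.symm.mono ?_⟩
  rintro p (rfl | hp)
  · exact Or.inl rfl
  · exact Or.inr hp

/-- A finite partial isomorphism into a generic sided switchboard extends to any finite set of
vertices of the other one. -/
theorem IsGeneric.exists_extend {S : Sided M} {T : Sided N} (hT : T.IsGeneric) {r : Set (M × N)}
    (hr : r.Finite) (h : PartialIso S T r) {s : Set M} (hs : s.Finite) :
    ∃ r', r ⊆ r' ∧ r'.Finite ∧ PartialIso S T r' ∧ ∀ m ∈ s, ∃ n, (m, n) ∈ r' := by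
  induction s, hs using Set.Finite.induction_on with
  | empty => exact ⟨r, subset_rfl, hr, h, by simp⟩
  | @insert a s _ _ ih =>
    obtain ⟨r', hrr', hr', h', hs'⟩ := ih
    obtain ⟨n, hn⟩ := hT.exists_insert' hr' h' a
    refine ⟨insert (a, n) r', hrr'.trans (Set.subset_insert _ _), hr'.insert _, hn, ?_⟩
    rintro m (rfl | hm)
    · exact ⟨n, Or.inl rfl⟩
    · obtain ⟨n', hn'⟩ := hs' m hm
      exact ⟨n', Or.inr hn'⟩

/-- One-point extensions of a generic sided switchboard are realized over finite sets. -/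
theorem IsGeneric.exists_realize {S : Sided M} (hS : S.IsGeneric) {T : Sided (Option M)}
    (hT : T.comap some = S) {C : Set M} (hC : C.Finite) :
    ∃ y, PartialIso S T (insert (y, none) ((fun c => (c, some c)) '' C)) := by
  refine hS.exists_insert (hC.image _) ?_ none
  have := (partialIso_range (S := S) (T := T) (u := fun c : C => c.1)
    (v := fun c : C => some c.1)).2
    ⟨fun i j => by simp, by rw [← hT, comap_comap]; rfl⟩
  refine this.mono ?_
  rintro _ ⟨c, hc, rfl⟩
  exact ⟨⟨c, hc⟩, rfl⟩

/-! ### Sides are witnessed by edges in generic sided switchboards -/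

theorem map_some_ne {e : Sym2 M} {a : M} : e.map some ≠ s(some a, none) := by
  intro h
  have : none ∈ e.map some := h ▸ Sym2.mem_mk_right _ _
  simp at this

theorem map_some_inj {e f : Sym2 M} (h : e.map some = f.map some) : e = f :=
  Sym2.map.injective (Option.some_injective M) h

theorem some_mem_map {e : Sym2 M} {a : M} : some a ∈ e.map some ↔ a ∈ e := by simp

/-- The extension of `S` by a new vertex `c` with `e < {a, c}`. -/
def addAbove (S : Sided M) (a : M) (e : Sym2 M) (h : S.below a e) : Sided (Option M) where
  lt e₁ e₂ := (∃ f g, S.lt f g ∧ f.map some = e₁ ∧ g.map some = e₂) ∨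
    ∃ g, (g = e ∨ S.lt g e) ∧ g.map some = e₁ ∧ s(some a, none) = e₂
  below v e₁ := (∃ b g, S.below b g ∧ some b = v ∧ g.map some = e₁) ∨
    (none = v ∧ ∃ g, (g = e ∨ S.lt g e) ∧ g.map some = e₁)
  trans := by
    rintro _ _ _ (⟨f, g, h1, rfl, rfl⟩ | ⟨g, h1, rfl, rfl⟩)
      (⟨f', g', h1', h2, rfl⟩ | ⟨g', h1', h2, rfl⟩)
    · obtain rfl := map_some_inj h2
      exact Or.inl ⟨_, _, S.trans h1 h1', rfl, rfl⟩
    · obtain rfl := map_some_inj h2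
      refine Or.inr ⟨_, Or.inr ?_, rfl, rfl⟩
      rcases h1' with rfl | h1'
      exacts [h1, S.trans h1 h1']
    · exact (map_some_ne h2).elim
    · exact (map_some_ne h2).elim
  lt_right := by
    rintro _ _ (⟨f, g, h1, rfl, rfl⟩ | ⟨g, h1, rfl, rfl⟩)
    · rw [Sym2.isDiag_map (Option.some_injective M)]
      exact S.lt_right h1
    · simp
  below_edge := by
    rintro _ _ (⟨b, g, h1, rfl, rfl⟩ | ⟨rfl, g, h1, rfl⟩)
    · rw [Sym2.isDiag_map (Option.some_injective M)]
      exact S.below_edge h1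
    · rw [Sym2.isDiag_map (Option.some_injective M)]
      rcases h1 with rfl | h1
      exacts [S.below_edge h, S.lt_left h1]
  below_notMem := by
    rintro _ _ (⟨b, g, h1, rfl, rfl⟩ | ⟨rfl, g, h1, rfl⟩)
    · rw [some_mem_map]
      exact S.below_notMem h1
    · simp
  below_of_lt := by
    rintro v _ _ (⟨f, g, h1, rfl, rfl⟩ | ⟨g, h1, rfl, rfl⟩)
      (h2 | ⟨b, g', h2, rfl, h3⟩ | ⟨rfl, g', h2, h3⟩)
    · obtain ⟨b, hb, rfl⟩ := Sym2.mem_map.1 h2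
      exact Or.inl ⟨b, f, S.below_of_lt h1 (Or.inl hb), rfl, rfl⟩
    · obtain rfl := map_some_inj h3
      exact Or.inl ⟨b, f, S.below_of_lt h1 (Or.inr h2), rfl, rfl⟩
    · obtain rfl := map_some_inj h3
      refine Or.inr ⟨rfl, f, Or.inr ?_, rfl⟩
      rcases h2 with rfl | h2
      exacts [h1, S.trans h1 h2]
    · rcases Sym2.mem_iff.1 h2 with rfl | rfl
      · refine Or.inl ⟨a, g, ?_, rfl, rfl⟩
        rcases h1 with rfl | h1
        exacts [h, S.below_of_lt h1 (Or.inr h)]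
      · exact Or.inr ⟨rfl, g, h1, rfl⟩
    · exact (map_some_ne h3).elim
    · exact (map_some_ne h3).elim

theorem comap_addAbove (S : Sided M) (a : M) (e : Sym2 M) (h : S.below a e) :
    (S.addAbove a e h).comap some = S := by
  ext f g
  · constructor
    · rintro (⟨f', g', h1, h2, h3⟩ | ⟨g', h1, h2, h3⟩)
      · rwa [← map_some_inj h2, ← map_some_inj h3]
      · exact (map_some_ne h3.symm).elim
    · exact fun h1 => Or.inl ⟨f, g, h1, rfl, rfl⟩
  · constructor
    · rintro (⟨f', g', h1, h2, h3⟩ | ⟨h1, -⟩)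
      · rwa [← Option.some_injective M h2, ← map_some_inj h3]
      · cases h1
    · exact fun h1 => Or.inl ⟨f, g, h1, rfl, rfl⟩

/-- The extension of `S` by a new vertex `b` with `{a, b} < e`. -/
def addBelow (S : Sided M) (a : M) (e : Sym2 M) (hd : ¬ e.IsDiag) (ha : a ∉ e)
    (h : ¬ S.below a e) : Sided (Option M) where
  lt e₁ e₂ := (∃ f g, S.lt f g ∧ f.map some = e₁ ∧ g.map some = e₂) ∨
    ∃ g, (e = g ∨ S.lt e g) ∧ s(some a, none) = e₁ ∧ g.map some = e₂
  below v e₁ := (∃ b g, S.below b g ∧ some b = v ∧ g.map some = e₁) ∨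
    (∃ b, (b ∈ e ∨ S.below b e) ∧ some b = v ∧ s(some a, none) = e₁)
  trans := by
    rintro _ _ _ (⟨f, g, h1, rfl, rfl⟩ | ⟨g, h1, rfl, rfl⟩)
      (⟨f', g', h1', h2, rfl⟩ | ⟨g', h1', h2, rfl⟩)
    · obtain rfl := map_some_inj h2
      exact Or.inl ⟨_, _, S.trans h1 h1', rfl, rfl⟩
    · exact (map_some_ne h2.symm).elim
    · obtain rfl := map_some_inj h2
      refine Or.inr ⟨_, Or.inr ?_, rfl, rfl⟩
      rcases h1 with rfl | h1
      exacts [h1', S.trans h1 h1']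
    · exact (map_some_ne h2.symm).elim
  lt_right := by
    rintro _ _ (⟨f, g, h1, rfl, rfl⟩ | ⟨g, h1, rfl, rfl⟩)
    · rw [Sym2.isDiag_map (Option.some_injective M)]
      exact S.lt_right h1
    · rw [Sym2.isDiag_map (Option.some_injective M)]
      rcases h1 with rfl | h1
      exacts [hd, S.lt_right h1]
  below_edge := by
    rintro _ _ (⟨b, g, h1, rfl, rfl⟩ | ⟨b, h1, rfl, rfl⟩)
    · rw [Sym2.isDiag_map (Option.some_injective M)]
      exact S.below_edge h1
    · simp
  below_notMem := by
    rintro _ _ (⟨b, g, h1, rfl, rfl⟩ | ⟨b, h1, rfl, rfl⟩)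
    · rw [some_mem_map]
      exact S.below_notMem h1
    · rw [Sym2.mem_iff]
      rintro (h2 | h2)
      · obtain rfl := Option.some_injective M h2
        exact h1.elim ha h
      · cases h2
  below_of_lt := by
    rintro v _ _ (⟨f, g, h1, rfl, rfl⟩ | ⟨g, h1, rfl, rfl⟩)
      (h2 | ⟨b, g', h2, rfl, h3⟩ | ⟨b, h2, rfl, h3⟩)
    · obtain ⟨b, hb, rfl⟩ := Sym2.mem_map.1 h2
      exact Or.inl ⟨b, f, S.below_of_lt h1 (Or.inl hb), rfl, rfl⟩
    · obtain rfl := map_some_inj h3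
      exact Or.inl ⟨b, f, S.below_of_lt h1 (Or.inr h2), rfl, rfl⟩
    · exact (map_some_ne h3.symm).elim
    · obtain ⟨b, hb, rfl⟩ := Sym2.mem_map.1 h2
      refine Or.inr ⟨b, ?_, rfl, rfl⟩
      rcases h1 with rfl | h1
      exacts [Or.inl hb, Or.inr (S.below_of_lt h1 (Or.inl hb))]
    · obtain rfl := map_some_inj h3
      refine Or.inr ⟨b, Or.inr ?_, rfl, rfl⟩
      rcases h1 with rfl | h1
      exacts [h2, S.below_of_lt h1 (Or.inr h2)]
    · exact (map_some_ne h3.symm).elim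

theorem comap_addBelow (S : Sided M) (a : M) (e : Sym2 M) (hd : ¬ e.IsDiag) (ha : a ∉ e)
    (h : ¬ S.below a e) : (S.addBelow a e hd ha h).comap some = S := by
  ext f g
  · constructor
    · rintro (⟨f', g', h1, h2, h3⟩ | ⟨g', h1, h2, h3⟩)
      · rwa [← map_some_inj h2, ← map_some_inj h3]
      · exact (map_some_ne h2.symm).elim
    · exact fun h1 => Or.inl ⟨f, g, h1, rfl, rfl⟩
  · constructor
    · rintro (⟨f', g', h1, h2, h3⟩ | ⟨b, h1, h2, h3⟩)
      · rwa [← Option.some_injective M h2, ← map_some_inj h3]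
      · exact (map_some_ne h3.symm).elim
    · exact fun h1 => Or.inl ⟨f, g, h1, rfl, rfl⟩

theorem IsGeneric.below_iff {S : Sided M} (hS : S.IsGeneric) {a : M} {e : Sym2 M} :
    S.below a e ↔ ∃ c, S.lt e s(a, c) := by
  refine ⟨fun h => ?_, fun ⟨c, hc⟩ => S.below_of_lt hc (Or.inl (Sym2.mem_mk_left a c))⟩
  induction e using Sym2.ind with
  | _ x y =>
    obtain ⟨c, hc⟩ := hS.exists_realize (S.comap_addAbove a _ h) (Set.toFinite {a, x, y})
    have hmem : ∀ z ∈ ({a, x, y} : Set M),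
        (z, some z) ∈ insert (c, none) ((fun c => (c, some c)) '' ({a, x, y} : Set M)) :=
      fun z hz => Or.inr ⟨z, hz, rfl⟩
    refine ⟨c, (hc.lt (hmem x (by simp)) (hmem y (by simp)) (hmem a (by simp)) (Or.inl rfl)).2 ?_⟩
    exact Or.inr ⟨_, Or.inl rfl, rfl, rfl⟩

theorem IsGeneric.not_below_iff {S : Sided M} (hS : S.IsGeneric) {a : M} {e : Sym2 M}
    (hd : ¬ e.IsDiag) (ha : a ∉ e) : ¬ S.below a e ↔ ∃ b, S.lt s(a, b) e := by
  refine ⟨fun h => ?_, fun ⟨c, hc⟩ h =>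
    S.below_notMem (S.below_of_lt hc (Or.inr h)) (Sym2.mem_mk_left a c)⟩
  induction e using Sym2.ind with
  | _ x y =>
    obtain ⟨c, hc⟩ := hS.exists_realize (S.comap_addBelow a _ hd ha h) (Set.toFinite {a, x, y})
    have hmem : ∀ z ∈ ({a, x, y} : Set M),
        (z, some z) ∈ insert (c, none) ((fun c => (c, some c)) '' ({a, x, y} : Set M)) :=
      fun z hz => Or.inr ⟨z, hz, rfl⟩
    refine ⟨c, (hc.lt (hmem a (by simp)) (Or.inl rfl) (hmem x (by simp)) (hmem y (by simp))).2 ?_⟩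
    exact Or.inr ⟨_, Or.inl rfl, rfl, rfl⟩

/-! ### Uniqueness of the countable generic sided switchboard -/

/-- Back and forth. -/
theorem IsGeneric.exists_equiv [Countable M] [Nonempty M] [Countable N] [Nonempty N] {S : Sided M}
    {T : Sided N} (hS : S.IsGeneric) (hT : T.IsGeneric) : ∃ f : M ≃ N, T.comap f = S := by
  obtain ⟨a, ha⟩ := exists_surjective_nat M
  obtain ⟨b, hb⟩ := exists_surjective_nat N
  have step : ∀ (k : ℕ) (r : {r : Set (M × N) // r.Finite ∧ PartialIso S T r}),
      ∃ r' : {r : Set (M × N) // r.Finite ∧ PartialIso S T r},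
        r.1 ⊆ r'.1 ∧ (∃ n, (a k, n) ∈ r'.1) ∧ ∃ m, (m, b k) ∈ r'.1 := by
    rintro k ⟨r, hr, h⟩
    obtain ⟨n, hn⟩ := hT.exists_insert' hr h (a k)
    obtain ⟨m, hm⟩ := hS.exists_insert (hr.insert _) hn (b k)
    exact ⟨⟨_, (hr.insert _).insert _, hm⟩, (Set.subset_insert _ _).trans (Set.subset_insert _ _),
      ⟨n, Or.inr (Or.inl rfl)⟩, ⟨m, Or.inl rfl⟩⟩
  choose next hsub hfst hsnd using step
  have h0 : PartialIso S T ∅ := ⟨by simp, by simp, by simp⟩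
  let r : ℕ → {r : Set (M × N) // r.Finite ∧ PartialIso S T r} :=
    fun k => Nat.rec ⟨∅, Set.finite_empty, h0⟩ next k
  have hmono : Monotone fun k => (r k).1 := monotone_nat_of_le_succ fun k => hsub k (r k)
  have htot : ∀ m, ∃ n k, (m, n) ∈ (r k).1 := by
    intro m
    obtain ⟨k, rfl⟩ := ha m
    obtain ⟨n, hn⟩ := hfst k (r k)
    exact ⟨n, k + 1, hn⟩
  choose f i hf using htot
  have hi : ∀ {m k}, i m ≤ k → (m, f m) ∈ (r k).1 := fun h => hmono h (hf _)
  have hbij : f.Bijective := by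
    constructor
    · intro m m' hmm'
      exact ((r (i m ⊔ i m')).2.2.eq (hi le_sup_left) (hi le_sup_right)).2 hmm'
    · intro n
      obtain ⟨k, rfl⟩ := hb n
      obtain ⟨m, hm⟩ := hsnd k (r k)
      have hm' : (m, b k) ∈ (r (k + 1)).1 := hm
      exact ⟨m, ((r (i m ⊔ (k + 1))).2.2.eq (hi le_sup_left) (hmono le_sup_right hm')).1 rfl⟩
  refine ⟨Equiv.ofBijective f hbij, ?_⟩
  have : S.comap id = T.comap f := by
    rw [comap_eq_comap_iff]
    constructor
    · intro x y z t
      have h : ∀ {m}, m = x ∨ m = y ∨ m = z ∨ m = t →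
          (m, f m) ∈ (r (i x ⊔ i y ⊔ i z ⊔ i t)).1 := by
        rintro m (rfl | rfl | rfl | rfl) <;> exact hi (by simp)
      exact (r _).2.2.lt (h (Or.inl rfl)) (h (by simp)) (h (by simp)) (h (by simp))
    · intro x y z
      have h : ∀ {m}, m = x ∨ m = y ∨ m = z → (m, f m) ∈ (r (i x ⊔ i y ⊔ i z)).1 := by
        rintro m (rfl | rfl | rfl) <;> exact hi (by simp)
      exact (r _).2.2.below (h (Or.inl rfl)) (h (by simp)) (h (by simp))
  change T.comap f = S
  rw [← this]
  ext <;> simp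

end Sided

/-! ### The theory of generic switchboards -/

section

variable {M : Type*}

/-- The relation symbol of the structure on `M` is interpreted by the order of `S`. -/
def Represents [Lsw.Structure M] (S : Sided M) : Prop :=
  ∀ x y z t : M, Rlt x y z t ↔ S.lt s(x, y) s(z, t)

/-- The first-order structure of a sided switchboard; the sides are forgotten. -/
@[reducible]
def Sided.toStructure (S : Sided M) : Lsw.Structure M where
  funMap f := nomatch f
  RelMap r v := match r, v with
    | SwRel.lt, v => S.lt s(v 0, v 1) s(v 2, v 3)

theorem Sided.represents_toStructure (S : Sided M) : @Represents M S.toStructure S :=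
  fun _ _ _ _ => Iff.rfl

variable [Lsw.Structure M]

theorem Represents.model {S : Sided M} (hS : Represents S) : M ⊨ switchboardTheory := by
  rw [model_iff_axioms]
  simp only [hS _ _ _ _]
  refine ⟨fun x y z t h => ⟨?_, ?_⟩, fun x y z t h => ?_, fun x y z t h => ?_,
    fun x y => S.lt_irrefl _, fun x y z t p q => S.trans,
    fun x y z _ _ _ => ⟨fun h => ?_, fun h => ?_⟩⟩
  · simpa using S.lt_left h
  · simpa using S.lt_right h
  · rwa [Sym2.eq_swap]
  · rwa [Sym2.eq_swap (a := t)]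
  · exact S.lt_disjoint h (Sym2.mem_mk_left x y) (Sym2.mem_mk_left x z)
  · exact S.lt_disjoint h (Sym2.mem_mk_left x z) (Sym2.mem_mk_left x y)

/-- Every switchboard has a canonical choice of sides: `e` is below `a` if `e < {a, c}` for
some `c`. -/
theorem exists_represents (h : M ⊨ switchboardTheory) :
    ∃ S : Sided M, Represents S ∧ ∀ a e, S.below a e ↔ ∃ c, S.lt e s(a, c) := by
  rw [model_iff_axioms] at h
  obtain ⟨hne, hl, hr, hirr, htr, hinc⟩ := h
  let lt : Sym2 M → Sym2 M → Prop := fun e f =>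
    ∃ x y z t, e = s(x, y) ∧ f = s(z, t) ∧ Rlt x y z t
  have lt_iff : ∀ x y z t, Rlt x y z t ↔ lt s(x, y) s(z, t) := by
    intro x y z t
    refine ⟨fun h => ⟨x, y, z, t, rfl, rfl, h⟩, ?_⟩
    rintro ⟨x', y', z', t', he, hf, h⟩
    rcases Sym2.eq_iff.mp he with ⟨rfl, rfl⟩ | ⟨rfl, rfl⟩ <;>
    rcases Sym2.eq_iff.mp hf with ⟨rfl, rfl⟩ | ⟨rfl, rfl⟩
    exacts [h, hr _ _ _ _ h, hl _ _ _ _ h, hl _ _ _ _ (hr _ _ _ _ h)]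
  have htrans : ∀ {e f g}, lt e f → lt f g → lt e g := by
    intro e f g
    induction e using Sym2.ind
    induction f using Sym2.ind
    induction g using Sym2.ind
    rw [← lt_iff, ← lt_iff, ← lt_iff]
    exact htr _ _ _ _ _ _
  refine ⟨⟨lt, fun a e => ∃ c, lt e s(a, c), htrans, ?_, ?_, ?_, ?_⟩, lt_iff, fun a e => Iff.rfl⟩
  · rintro _ _ ⟨x, y, z, t, rfl, rfl, h⟩
    simpa using (hne _ _ _ _ h).2
  · rintro a _ ⟨c, x, y, z, t, rfl, -, h⟩
    simpa using (hne _ _ _ _ h).1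
  · rintro a e ⟨c, hc⟩ ha
    obtain ⟨b, rfl⟩ := ha
    rw [← lt_iff] at hc
    by_cases hbc : b = c
    · subst hbc
      exact hirr _ _ hc
    · exact (hinc a b c (hne _ _ _ _ hc).1 (hne _ _ _ _ hc).2 hbc).1 hc
  · rintro a e f h (⟨b, rfl⟩ | ⟨c, hc⟩)
    · exact ⟨b, h⟩
    · exact ⟨c, htrans h hc⟩

end

open scoped Classical in
/-- The formula `φ` if `p` holds, and its negation otherwise. -/
noncomputable def signed {n : ℕ} (p : Prop) (φ : Lsw.BoundedFormula Empty n) :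
    Lsw.BoundedFormula Empty n :=
  if p then φ else ∼φ

theorem realize_signed {M : Type*} [Lsw.Structure M] {n : ℕ} {p : Prop}
    {φ : Lsw.BoundedFormula Empty n} {v : Empty → M} {xs : Fin n → M} :
    (signed p φ).Realize v xs ↔ (φ.Realize v xs ↔ p) := by
  unfold signed
  split_ifs with h <;> simp [h]

/-- The formula `∃ c, {xⱼ, xₖ} < {xᵢ, c}`, which defines the canonical sides. -/
noncomputable def belowF {n : ℕ} (i j k : Fin n) : Lsw.BoundedFormula Empty n :=
  (ltF j.castSucc k.castSucc i.castSucc (Fin.last n)).ex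

/-- The formula saying that the variables are distinct and that the sided switchboard on them
is `T`. -/
noncomputable def diagramF {n : ℕ} (T : Sided (Fin n)) : Lsw.BoundedFormula Empty n :=
  BoundedFormula.iInf (fun p : Fin n × Fin n => signed (p.1 = p.2) (eqF p.1 p.2)) ⊓
  (BoundedFormula.iInf (fun p : (Fin n × Fin n) × Fin n × Fin n =>
    signed (T.lt s(p.1.1, p.1.2) s(p.2.1, p.2.2)) (ltF p.1.1 p.1.2 p.2.1 p.2.2)) ⊓
  BoundedFormula.iInf (fun p : Fin n × Fin n × Fin n =>
    signed (T.below p.1 s(p.2.1, p.2.2)) (belowF p.1 p.2.1 p.2.2)))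

theorem Sided.comap_id {M : Type*} (S : Sided M) : S.comap id = S := by
  ext <;> simp

theorem realize_diagramF {M : Type*} [Lsw.Structure M] {S : Sided M} (hS : Represents S)
    (hb : ∀ a e, S.below a e ↔ ∃ c, S.lt e s(a, c)) {n : ℕ} {T : Sided (Fin n)}
    {v : Empty → M} {xs : Fin n → M} :
    (diagramF T).Realize v xs ↔ xs.Injective ∧ S.comap xs = T := by
  conv_rhs => rw [← T.comap_id, Sided.comap_eq_comap_iff]
  simp only [diagramF, BoundedFormula.realize_inf, BoundedFormula.realize_iInf, realize_signed,
    belowF, BoundedFormula.realize_ex, realize_ltF, realize_eqF, Fin.snoc_castSucc, Fin.snoc_last,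
    hS _ _ _ _, ← hb, Prod.forall, id]
  refine and_congr ⟨fun h i j => (h i j).1, fun h i j => h.eq_iff⟩ Iff.rfl

/-- The theory of switchboards in which, with respect to the canonical sides, every one-point
extension of a finite part is realized. -/
noncomputable def genericTheory : Lsw.Theory :=
  switchboardTheory ∪ Set.range fun p : Σ k : ℕ, Sided (Fin (k + 1)) =>
    (diagramF (p.2.comap Fin.castSucc) ⟹ (diagramF p.2).ex).alls

theorem model_genericTheory_iff {M : Type*} [Lsw.Structure M] :
    M ⊨ genericTheory ↔ ∃ S : Sided M, Represents S ∧ S.IsGeneric := by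
  have key : ∀ S : Sided M, Represents S → (∀ a e, S.below a e ↔ ∃ c, S.lt e s(a, c)) →
      (M ⊨ Set.range (fun p : Σ k : ℕ, Sided (Fin (k + 1)) =>
        (diagramF (p.2.comap Fin.castSucc) ⟹ (diagramF p.2).ex).alls) ↔ S.IsGeneric) := by
    intro S hS hb
    simp only [Theory.model_iff, Set.forall_mem_range, Sentence.Realize,
      BoundedFormula.realize_alls, BoundedFormula.realize_imp, BoundedFormula.realize_ex,
      realize_diagramF hS hb, Sigma.forall]
    refine forall_congr' fun k => forall_congr' fun T => forall_congr' fun x => ?_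
    constructor
    · intro h hx hT
      obtain ⟨y, hy, hy'⟩ := h ⟨hx, hT.symm⟩
      refine ⟨y, ?_, hy'⟩
      rintro ⟨i, hi⟩
      have : i.castSucc = Fin.last k := hy (by simpa using hi)
      exact (Fin.castSucc_lt_last i).ne this
    · rintro h ⟨hx, hT⟩
      obtain ⟨y, hy, hy'⟩ := h hx hT.symm
      exact ⟨y, Sided.append_injective hx hy, hy'⟩
  constructor
  · intro h
    have h1 : M ⊨ switchboardTheory := h.mono Set.subset_union_left
    obtain ⟨S, hS, hb⟩ := exists_represents h1
    exact ⟨S, hS, (key S hS hb).1 (h.mono Set.subset_union_right)⟩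
  · rintro ⟨S, hS, hG⟩
    exact hS.model.union ((key S hS fun a e => hG.below_iff).2 hG)

/-! ### Back and forth for formulas -/

theorem term_eq_var {β : Type*} (t : Lsw.Term β) : ∃ b, t = Term.var b := by
  cases t with
  | var b => exact ⟨b, rfl⟩
  | func f _ => exact nomatch f

theorem relMap_lt_iff {M : Type*} [Lsw.Structure M] {S : Sided M} (hS : Represents S)
    (x : Fin 4 → M) : Structure.RelMap (L := Lsw) SwRel.lt x ↔ S.lt s(x 0, x 1) s(x 2, x 3) := by
  rw [← hS, Rlt]
  have : x = ![x 0, x 1, x 2, x 3] := by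
    funext i; fin_cases i <;> rfl
  conv_lhs => rw [this]
  rfl

/-- Finite partial isomorphisms between generic switchboards are elementary: the truth of a formula
depends only on the sided switchboard on the finitely many parameters that occur in it. -/
theorem exists_finite_realize_iff {α : Type*} {n : ℕ} (φ : Lsw.BoundedFormula α n) :
    ∃ s : Set α, s.Finite ∧ ∀ {M N : Type w} [Lsw.Structure M] [Lsw.Structure N]
      {S : Sided M} {T : Sided N}, Represents S → Represents T → S.IsGeneric → T.IsGeneric →
      ∀ {v : α → M} {xs : Fin n → M} {v' : α → N} {xs' : Fin n → N},
      S.PartialIso T ((fun a => (v a, v' a)) '' s ∪ Set.range fun i => (xs i, xs' i)) →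
      (φ.Realize v xs ↔ φ.Realize v' xs') := by
  -- the parameters of a single term, and the value of the term
  have term : ∀ {n : ℕ} (t : Lsw.Term (α ⊕ Fin n)), ∃ s : Set α, s.Finite ∧ ∀ {M N : Type w}
      [Lsw.Structure M] [Lsw.Structure N] {v : α → M} {xs : Fin n → M} {v' : α → N}
      {xs' : Fin n → N}, (t.realize (Sum.elim v xs), t.realize (Sum.elim v' xs')) ∈
        ((fun a => (v a, v' a)) '' s ∪ Set.range fun i => (xs i, xs' i)) := by
    intro n t
    obtain ⟨a | i, rfl⟩ := term_eq_var t
    · exact ⟨{a}, Set.finite_singleton a, Or.inl ⟨a, rfl, rfl⟩⟩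
    · exact ⟨∅, Set.finite_empty, Or.inr ⟨i, rfl⟩⟩
  induction φ with
  | falsum => exact ⟨∅, Set.finite_empty, fun _ _ _ _ _ _ _ _ _ => Iff.rfl⟩
  | equal t₁ t₂ =>
    obtain ⟨s₁, hs₁, h₁⟩ := term t₁
    obtain ⟨s₂, hs₂, h₂⟩ := term t₂
    refine ⟨s₁ ∪ s₂, hs₁.union hs₂, fun _ _ _ _ v xs v' xs' h => ?_⟩
    exact h.eq (Set.union_subset_union_left _ (Set.image_mono Set.subset_union_left) h₁)
      (Set.union_subset_union_left _ (Set.image_mono Set.subset_union_right) h₂)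
  | rel R ts =>
    cases R
    choose s hs hts using fun i => term (ts i)
    refine ⟨⋃ i, s i, Set.finite_iUnion hs, fun hS hT _ _ v xs v' xs' h => ?_⟩
    have hmem := fun i => Set.union_subset_union_left (Set.range fun i => (xs i, xs' i))
      (Set.image_mono (f := fun a => (v a, v' a)) (Set.subset_iUnion s i)) (hts i)
    have := h.lt (hmem 0) (hmem 1) (hmem 2) (hmem 3)
    exact (relMap_lt_iff hS fun i => (ts i).realize (Sum.elim v xs)).trans
      (this.trans (relMap_lt_iff hT fun i => (ts i).realize (Sum.elim v' xs')).symm)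
  | imp φ₁ φ₂ ih₁ ih₂ =>
    obtain ⟨s₁, hs₁, h₁⟩ := ih₁
    obtain ⟨s₂, hs₂, h₂⟩ := ih₂
    refine ⟨s₁ ∪ s₂, hs₁.union hs₂, fun hS hT hS' hT' v xs v' xs' h => ?_⟩
    exact imp_congr
      (h₁ hS hT hS' hT' (h.mono
        (Set.union_subset_union_left _ (Set.image_mono Set.subset_union_left))))
      (h₂ hS hT hS' hT' (h.mono
        (Set.union_subset_union_left _ (Set.image_mono Set.subset_union_right))))
  | all φ ih =>
    obtain ⟨s, hs, ih⟩ := ih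
    refine ⟨s, hs, fun {M N} _ _ S T hS hT hS' hT' v xs v' xs' h => ?_⟩
    have hfin := (hs.image fun a => (v a, v' a)).union (Set.finite_range fun i => (xs i, xs' i))
    have step : ∀ a a', S.PartialIso T (insert (a, a')
        ((fun a => (v a, v' a)) '' s ∪ Set.range fun i => (xs i, xs' i))) →
        (φ.Realize v (Fin.snoc xs a) ↔ φ.Realize v' (Fin.snoc xs' a')) := by
      intro a a' haa'
      refine ih hS hT hS' hT' (haa'.mono ?_)
      rintro _ (h | ⟨i, rfl⟩)
      · exact Or.inr (Or.inl h)
      · induction i using Fin.lastCases with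
        | last => simp
        | cast i => exact Or.inr (Or.inr ⟨i, by simp⟩)
    constructor
    · intro h1 a'
      obtain ⟨a, ha⟩ := hS'.exists_insert hfin h a'
      exact (step a a' ha).1 (h1 a)
    · intro h1 a
      obtain ⟨a', ha'⟩ := hT'.exists_insert' hfin h a
      exact (step a a' ha').2 (h1 a')

/-! ### Model companion, completeness, categoricity and the strict order property -/

theorem isModelComplete_genericTheory : IsModelComplete.{0, 0, w} genericTheory := by
  intro M N f
  obtain ⟨S, hS, hS'⟩ := model_genericTheory_iff.1 M.is_model
  obtain ⟨T, hT, hT'⟩ := model_genericTheory_iff.1 N.is_model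
  have hlt : ∀ x y z t : M, S.lt s(x, y) s(z, t) ↔ T.lt s(f x, f y) s(f z, f t) := by
    intro x y z t
    have h := f.map_rel (SwRel.lt : Lsw.Relations 4) ![x, y, z, t]
    exact ((relMap_lt_iff hS ![x, y, z, t]).symm.trans h.symm).trans
      (relMap_lt_iff hT (f ∘ ![x, y, z, t]))
  -- both sides of a vertex are existentially definable, hence preserved by embeddings
  have hbelow : ∀ x y z : M, S.below x s(y, z) ↔ T.below (f x) s(f y, f z) := by
    intro x y z
    constructor
    · rw [hS'.below_iff, hT'.below_iff]
      rintro ⟨c, hc⟩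
      exact ⟨f c, (hlt _ _ _ _).1 hc⟩
    · intro h
      have hd := T.below_edge h
      have hm := T.below_notMem h
      by_contra hn
      have hd' : ¬ s(y, z).IsDiag := by
        intro hd'
        rw [Sym2.mk_isDiag_iff] at hd hd'
        exact hd (congrArg f hd')
      have hm' : x ∉ s(y, z) := by
        rw [Sym2.mem_iff] at hm ⊢
        exact fun h => hm (h.imp (congrArg f) (congrArg f))
      obtain ⟨b, hb⟩ := (hS'.not_below_iff hd' hm').1 hn
      exact (hT'.not_below_iff hd hm).2 ⟨f b, (hlt _ _ _ _).1 hb⟩ h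
  refine ⟨⟨f, fun n φ x => ?_⟩, by ext; rfl⟩
  obtain ⟨s, -, h⟩ := exists_finite_realize_iff φ
  refine (h hS hT hS' hT' (Sided.PartialIso.mono (r' := Set.range fun m => (m, f m)) ?_ ?_)).symm
  · rw [Sided.partialIso_range]
    exact ⟨fun i j => f.injective.eq_iff.symm,
      Sided.comap_eq_comap_iff.2 ⟨fun _ _ _ _ => hlt _ _ _ _, fun _ _ _ => hbelow _ _ _⟩⟩
  · rintro _ (⟨i, -, rfl⟩ | ⟨i, rfl⟩)
    · exact ⟨x i, rfl⟩
    · exact i.elim0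

theorem isModelCompanion_genericTheory :
    IsModelCompanion.{0, 0, w} switchboardTheory genericTheory where
  embeds M := by
    obtain ⟨S, hS, -⟩ := exists_represents M.is_model
    obtain ⟨N, T, f, hf, hT, hG⟩ := S.exists_isGeneric
    let := T.toStructure
    have hN : N ⊨ genericTheory := model_genericTheory_iff.2 ⟨T, T.represents_toStructure, hG⟩
    have : Nonempty N := M.nonempty'.map f
    refine ⟨⟨N⟩, ⟨⟨⟨f, hf⟩, fun g => (nomatch g), ?_⟩⟩⟩
    rintro n r x
    cases r
    refine Iff.trans ?_ (relMap_lt_iff hS x).symm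
    rw [← hT]
    exact Iff.rfl
  embeds' N := by
    obtain ⟨S, hS, -⟩ := model_genericTheory_iff.1 N.is_model
    have := hS.model
    exact ⟨⟨N⟩, ⟨Embedding.refl _ _⟩⟩
  modelComplete := isModelComplete_genericTheory

/-- The sided switchboard on `ℕ` with `{0, 1} < {2, 3} < {4, 5} < ⋯` and no other relations. -/
def chainSided : Sided ℕ where
  lt e f := ∃ i j, i < j ∧ e = s(2 * i, 2 * i + 1) ∧ f = s(2 * j, 2 * j + 1)
  below a e := ∃ i, 2 * i + 1 < a ∧ e = s(2 * i, 2 * i + 1)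
  trans := by
    rintro _ _ _ ⟨i, j, h, rfl, rfl⟩ ⟨j', k, h', hj, rfl⟩
    have : j = j' := by rw [Sym2.eq_iff] at hj; omega
    exact ⟨i, k, by omega, rfl, rfl⟩
  lt_right := by
    rintro _ _ ⟨i, j, h, rfl, rfl⟩
    simp
  below_edge := by
    rintro _ _ ⟨i, h, rfl⟩
    simp
  below_notMem := by
    rintro a _ ⟨i, h, rfl⟩
    rw [Sym2.mem_iff]
    omega
  below_of_lt := by
    rintro a _ _ ⟨i, j, h, rfl, rfl⟩ (h' | ⟨j', h', hj⟩)
    · rw [Sym2.mem_iff] at h'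
      exact ⟨i, by omega, rfl⟩
    · have : j = j' := by rw [Sym2.eq_iff] at hj; omega
      exact ⟨i, by omega, rfl⟩

/-- There is a generic switchboard with an infinite ascending chain of edges. -/
theorem exists_generic_chain : ∃ (N : Type w) (S : Sided N) (f : ℕ → N), S.IsGeneric ∧
    ∀ i, S.lt s(f (2 * i), f (2 * i + 1)) s(f (2 * (i + 1)), f (2 * (i + 1) + 1)) := by
  obtain ⟨N, T, f, -, hT, hG⟩ :=
    (chainSided.comap (ULift.down : ULift.{w} ℕ → ℕ)).exists_isGeneric
  refine ⟨N, T, f ∘ ULift.up, hG, fun i => ?_⟩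
  have : ((T.comap f).comap ULift.up).lt s(2 * i, 2 * i + 1) s(2 * (i + 1), 2 * (i + 1) + 1) := by
    rw [hT]
    exact ⟨i, i + 1, by omega, by simp, by simp⟩
  exact this

theorem isComplete_genericTheory : genericTheory.IsComplete := by
  constructor
  · obtain ⟨N, S, f, hS, -⟩ := exists_generic_chain.{0}
    let := S.toStructure
    have : N ⊨ genericTheory := model_genericTheory_iff.2 ⟨S, S.represents_toStructure, hS⟩
    have : Nonempty N := ⟨f 0⟩
    exact ⟨⟨N⟩⟩
  · intro φ
    by_cases h : genericTheory ⊨ᵇ φ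
    · exact Or.inl h
    right
    rw [Theory.models_sentence_iff] at h ⊢
    push Not at h
    obtain ⟨M, hM⟩ := h
    intro N
    rw [Sentence.realize_not]
    refine fun hN => hM ?_
    obtain ⟨S, hS, hS'⟩ := model_genericTheory_iff.1 M.is_model
    obtain ⟨T, hT, hT'⟩ := model_genericTheory_iff.1 N.is_model
    obtain ⟨s, -, h⟩ := exists_finite_realize_iff φ
    refine (h hS hT hS' hT' ((Sided.PartialIso.mk ?_ ?_ ?_ : S.PartialIso T ∅).mono ?_)).2 hN
    · simp
    · simp
    · simp
    · rintro _ (⟨i, -, rfl⟩ | ⟨i, rfl⟩)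
      · exact i.elim
      · exact i.elim0

theorem categorical_genericTheory : Cardinal.Categorical Cardinal.aleph0.{w} genericTheory := by
  intro M N hM hN
  obtain ⟨S, hS, hS'⟩ := model_genericTheory_iff.1 M.is_model
  obtain ⟨T, hT, hT'⟩ := model_genericTheory_iff.1 N.is_model
  have : Countable M := Cardinal.mk_le_aleph0_iff.1 hM.le
  have : Countable N := Cardinal.mk_le_aleph0_iff.1 hN.le
  obtain ⟨f, hf⟩ := hS'.exists_equiv hT'
  refine ⟨⟨f, fun g => (nomatch g), ?_⟩⟩
  intro n r x
  cases r
  refine Iff.trans (relMap_lt_iff hT _) (Iff.trans ?_ (relMap_lt_iff hS x).symm)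
  rw [← hf]
  exact Iff.rfl

theorem hasSOP_genericTheory : HasSOP.{0, 0, w} genericTheory := by
  obtain ⟨N, S, f, hS, hf⟩ := exists_generic_chain.{w}
  let := S.toStructure
  have : N ⊨ genericTheory := model_genericTheory_iff.2 ⟨S, S.represents_toStructure, hS⟩
  have : Nonempty N := ⟨f 0⟩
  refine ⟨2, 2, ltSymb.formula ![Term.var (.inl 0), Term.var (.inl 1), Term.var (.inr 0),
    Term.var (.inr 1)], ⟨N⟩, fun i => ![f (2 * i), f (2 * i + 1)], fun i => ?_⟩
  have hmem : ∀ a b : Fin 2 → N, a ∈ solutionSet N (L := Lsw) (ltSymb.formula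
      ![Term.var (.inl 0), Term.var (.inl 1), Term.var (.inr 0), Term.var (.inr 1)]) b ↔
      S.lt s(a 0, a 1) s(b 0, b 1) := by
    intro a b
    exact (relMap_lt_iff S.represents_toStructure ![a 0, a 1, b 0, b 1])
  rw [Set.ssubset_iff_of_subset]
  · exact ⟨![f (2 * i), f (2 * i + 1)], (hmem _ _).2 (hf i),
      fun h => S.lt_irrefl _ ((hmem _ _).1 h)⟩
  · intro a ha
    exact (hmem _ _).2 (S.trans ((hmem _ _).1 ha) (hf i))

/-! ### Ascending chains of single vertices -/

/-- Ramsey's theorem for pairs, in the weak form of a homogeneous triple. -/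
theorem exists_homogeneous_triple {κ : Type*} [Finite κ] (col : ℕ → ℕ → κ) :
    ∃ i j k, i < j ∧ j < k ∧ col i j = col i k ∧ col i j = col j k := by
  let U : Ultrafilter ℕ := Filter.hyperfilter ℕ
  have lim : ∀ f : ℕ → κ, ∃ c, ∀ᶠ n in U, f n = c := by
    intro f
    obtain ⟨c, hc⟩ := Ultrafilter.eq_pure_of_finite (U.map f)
    refine ⟨c, ?_⟩
    have : {c} ∈ U.map f := by rw [hc]; exact Set.mem_singleton c
    exact this
  have gt : ∀ i, ∀ᶠ n in (U : Filter ℕ), i < n := by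
    intro i
    have : (U : Filter ℕ) ≤ Filter.atTop := by
      rw [← Nat.cofinite_eq_atTop]
      exact Filter.hyperfilter_le_cofinite
    exact this (Filter.eventually_gt_atTop i)
  choose χ hχ using fun i => lim (col i)
  obtain ⟨c, hc⟩ := lim χ
  obtain ⟨i, hi⟩ := hc.exists
  obtain ⟨j, ⟨hij, hj⟩, hcj⟩ := (((gt i).and (hχ i)).and hc).exists
  obtain ⟨k, ⟨hjk, hk⟩, hk'⟩ := (((gt j).and (hχ i)).and (hχ j)).exists
  exact ⟨i, j, k, hij, hjk, hj.trans hk.symm, by rw [hj, hk', hi, hcj]⟩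

theorem exists_rank {κ : Type*} [Finite κ] {R : κ → κ → Prop} (hirr : ∀ a, ¬ R a a)
    (htr : ∀ a b c, R a b → R b c → R a c) :
    ∃ rk : κ → ℕ, (∀ a, rk a ≤ Nat.card κ) ∧ ∀ a b, R a b → rk a < rk b := by
  refine ⟨fun b => {a | R a b}.ncard, fun a => ?_, fun a b hab => ?_⟩
  · rw [← Set.ncard_univ]
    exact Set.ncard_le_ncard (Set.subset_univ _) Set.finite_univ
  · refine Set.ncard_lt_ncard ?_ (Set.toFinite _)
    exact ⟨fun c hc => htr c a b hc hab, fun h => hirr a (h hab)⟩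

namespace Sided

variable {N : Type*}

instance [Finite N] : Finite (Sided N) :=
  Finite.of_injective (fun S : Sided N => (S.lt, S.below)) fun _ _ h =>
    Sided.ext (congrArg Prod.fst h) (congrArg Prod.snd h)

/-- The elements of `C` together with `d`, as an indexed family. -/
def adjoin (C : Set N) (d : N) : Option C → N := fun o => o.elim d Subtype.val

/-- The elements of `C` together with `d` and `e`, as an indexed family. -/
def adjoin₂ (C : Set N) (d e : N) : Option (Option C) → N := fun o => o.elim e (adjoin C d)

theorem adjoin_injective {C : Set N} {d : N} (hd : d ∉ C) : (adjoin C d).Injective := by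
  rintro (_ | c) (_ | c') h
  · rfl
  · exact (hd (by rw [show d = c' from h]; exact c'.2)).elim
  · exact (hd (by rw [← show c.1 = d from h]; exact c.2)).elim
  · exact congrArg some (Subtype.ext h)

theorem adjoin₂_injective {C : Set N} {d e : N} (hd : d ∉ C) (he : e ∉ C) (hde : d ≠ e) :
    (adjoin₂ C d e).Injective := by
  rintro (_ | x) (_ | y) h
  · rfl
  · exfalso
    rcases y with _ | c
    · exact hde h.symm
    · exact he (by rw [show e = c from h]; exact c.2)
  · exfalso
    rcases x with _ | c
    · exact hde h
    · exact he (by rw [← show c.1 = e from h]; exact c.2)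
  · exact congrArg some (adjoin_injective hd h)

/-- The vertex `d` has the same type as `b` over `C`, the pair `ψ b d` holds, and every relation
that would make the type of `(b, d)` over `C` differ from that of `(d, b)` requires `n` to be small.
Here `rk` and `rk'` are the bounds on the lengths of the chains of edges that produce such a
relation. -/
structure Far (S : Sided N) (C : Set N) (ψ : N → N → Prop) (b : N) (rk rk' : C → ℕ) (n : ℕ)
    (d : N) : Prop where
  ne : b ≠ d
  notMem : d ∉ C
  type_eq : S.comap (adjoin C b) = S.comap (adjoin C d)
  rel : ψ b d
  lt_up (c c' : C) : S.lt s(b, c) s(d, c') → n ≤ rk c'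
  lt_down (c c' : C) : S.lt s(d, c) s(b, c') → n ≤ rk' c
  below_left (c : C) : S.below b s(d, c) → n ≤ rk' c + 1
  below_right (c : C) : S.below d s(b, c) → n ≤ Nat.card C + 1
  edge_lt (c c' : C) : S.lt s(b, d) s(c.1, c'.1) → n ≤ 1
  lt_edge (c c' : C) : S.lt s(c.1, c'.1) s(b, d) → n ≤ 1
  below_edge' (c : C) : S.below c s(b, d) → n ≤ 1

section

variable {S : Sided N} {C : Set N}

theorem type_lt_left {b d : N} (h : S.comap (adjoin C b) = S.comap (adjoin C d)) (c c₁ c₂ : C) :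
    S.lt s(b, c) s(c₁.1, c₂.1) ↔ S.lt s(d, c) s(c₁.1, c₂.1) :=
  (comap_eq_comap_iff.1 h).1 none (some c) (some c₁) (some c₂)

theorem type_lt_right {b d : N} (h : S.comap (adjoin C b) = S.comap (adjoin C d)) (c c₁ c₂ : C) :
    S.lt s(c₁.1, c₂.1) s(b, c) ↔ S.lt s(c₁.1, c₂.1) s(d, c) :=
  (comap_eq_comap_iff.1 h).1 (some c₁) (some c₂) none (some c)

theorem type_below {b d : N} (h : S.comap (adjoin C b) = S.comap (adjoin C d)) (c₁ c₂ : C) :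
    S.below b s(c₁.1, c₂.1) ↔ S.below d s(c₁.1, c₂.1) :=
  (comap_eq_comap_iff.1 h).2 none (some c₁) (some c₂)

theorem type_below_edge {b d : N} (h : S.comap (adjoin C b) = S.comap (adjoin C d)) (c c₁ : C) :
    S.below c s(b, c₁) ↔ S.below c s(d, c₁) :=
  (comap_eq_comap_iff.1 h).2 (some c) none (some c₁)

theorem edge_cases (e : Sym2 (Option (Option C))) (he : ¬ e.IsDiag) :
    (∃ c c' : C, e = s(some (some c), some (some c'))) ∨
    (∃ c : C, e = s(some none, some (some c))) ∨ (∃ c : C, e = s(none, some (some c))) ∨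
    e = s(some none, none) := by
  induction e using Sym2.ind with
  | _ x y =>
    rw [Sym2.mk_isDiag_iff] at he
    rcases x with _ | _ | c <;> rcases y with _ | _ | c'
    · exact (he rfl).elim
    · exact Or.inr (Or.inr (Or.inr Sym2.eq_swap))
    · exact Or.inr (Or.inr (Or.inl ⟨c', rfl⟩))
    · exact Or.inr (Or.inr (Or.inr rfl))
    · exact (he rfl).elim
    · exact Or.inr (Or.inl ⟨c', rfl⟩)
    · exact Or.inr (Or.inr (Or.inl ⟨c, Sym2.eq_swap⟩))
    · exact Or.inr (Or.inl ⟨c, Sym2.eq_swap⟩)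
    · exact Or.inl ⟨c, c', rfl⟩

/-- For large `n`, the pairs `(b, d)` and `(d, b)` have the same type over `C`. -/
theorem Far.swap {ψ : N → N → Prop} {b : N} {rk rk' : C → ℕ} {n : ℕ} {d : N}
    (h : S.Far C ψ b rk rk' n d) (hrk : ∀ c, rk c ≤ Nat.card C) (hrk' : ∀ c, rk' c ≤ Nat.card C)
    (hn : Nat.card C + 2 ≤ n) : S.comap (adjoin₂ C b d) = S.comap (adjoin₂ C d b) := by
  let σ : Option (Option C) → Option (Option C) := fun
    | none => some none
    | some none => none
    | some (some c) => some (some c)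
  have hσσ : σ ∘ σ = id := by funext x; rcases x with _ | _ | c <;> rfl
  have hσ : adjoin₂ C d b = adjoin₂ C b d ∘ σ := by funext x; rcases x with _ | _ | c <;> rfl
  have lt : ∀ e f, (S.comap (adjoin₂ C b d)).lt e f →
      (S.comap (adjoin₂ C b d)).lt (e.map σ) (f.map σ) := by
    intro e f hl
    have hdis := fun a => (S.comap (adjoin₂ C b d)).lt_disjoint hl (a := a)
    rcases edge_cases e ((S.comap _).lt_left hl) with ⟨c₁, c₂, rfl⟩ | ⟨c, rfl⟩ | ⟨c, rfl⟩ | rfl <;>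
    rcases edge_cases f ((S.comap _).lt_right hl) with ⟨c₃, c₄, rfl⟩ | ⟨c', rfl⟩ | ⟨c', rfl⟩ | rfl
    · exact hl
    · exact (type_lt_right h.type_eq c' c₁ c₂).1 hl
    · exact (type_lt_right h.type_eq c' c₁ c₂).2 hl
    · have := h.lt_edge c₁ c₂ hl
      omega
    · exact (type_lt_left h.type_eq c c₃ c₄).1 hl
    · exact (hdis (some none) (by simp) (by simp)).elim
    · have := h.lt_up c c' hl
      have := hrk c'
      omega
    · exact (hdis (some none) (by simp) (by simp)).elim
    · exact (type_lt_left h.type_eq c c₃ c₄).2 hl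
    · have := h.lt_down c c' hl
      have := hrk' c
      omega
    · exact (hdis none (by simp) (by simp)).elim
    · exact (hdis none (by simp) (by simp)).elim
    · have := h.edge_lt c₃ c₄ hl
      omega
    · exact (hdis (some none) (by simp) (by simp)).elim
    · exact (hdis none (by simp) (by simp)).elim
    · exact (hdis none (by simp) (by simp)).elim
  have below : ∀ a e, (S.comap (adjoin₂ C b d)).below a e →
      (S.comap (adjoin₂ C b d)).below (σ a) (e.map σ) := by
    intro a e hl
    have hmem := (S.comap (adjoin₂ C b d)).below_notMem hl
    rcases edge_cases e ((S.comap _).below_edge hl) with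
      ⟨c₁, c₂, rfl⟩ | ⟨c, rfl⟩ | ⟨c, rfl⟩ | rfl <;>
    rcases a with _ | _ | c'
    · exact (type_below h.type_eq c₁ c₂).2 hl
    · exact (type_below h.type_eq c₁ c₂).1 hl
    · exact hl
    · have := h.below_right c hl
      omega
    · exact (hmem (by simp)).elim
    · exact (type_below_edge h.type_eq c' c).1 hl
    · exact (hmem (by simp)).elim
    · have := h.below_left c hl
      have := hrk' c
      omega
    · exact (type_below_edge h.type_eq c' c).2 hl
    · exact (hmem (by simp)).elim
    · exact (hmem (by simp)).elim
    · have := h.below_edge' c' hl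
      omega
  rw [hσ, ← comap_comap]
  have hmm : ∀ e : Sym2 (Option (Option C)), (e.map σ).map σ = e := by
    intro e
    rw [Sym2.map_map, hσσ, Sym2.map_id, id]
  ext e f
  · refine ⟨lt e f, fun hl => ?_⟩
    have := lt _ _ (show (S.comap (adjoin₂ C b d)).lt (e.map σ) (f.map σ) from hl)
    rwa [hmm, hmm] at this
  · refine ⟨below e f, fun hl => ?_⟩
    have := below _ _ (show (S.comap (adjoin₂ C b d)).below (σ e) (f.map σ) from hl)
    rwa [hmm, show σ (σ e) = e from congrFun hσσ e] at this

/-- If `d'` is chosen so that `(d, d')` has the type of `(b, b₁)` over `C`, as freely as possible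
from `b`, then the chains of edges leading from `b` to `d'` are longer than those leading to `d`. -/
theorem Far.exists_succ (hS : S.IsGeneric) (hC : C.Finite) {ψ : N → N → Prop}
    (htr : ∀ x y z, ψ x y → ψ y z → ψ x z)
    (hinv : ∀ d e d' e', (adjoin₂ C d e).Injective → (adjoin₂ C d' e').Injective →
      S.comap (adjoin₂ C d e) = S.comap (adjoin₂ C d' e') → ψ d e → ψ d' e')
    {b b₁ : N} {rk rk' : C → ℕ} (hb : b ∉ C) (hb₁ : b₁ ∉ C) (hbb₁ : b ≠ b₁) (hψ : ψ b b₁)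
    (htype : S.comap (adjoin C b) = S.comap (adjoin C b₁)) (hrk : ∀ c, rk c ≤ Nat.card C)
    (hR : ∀ c c' : C, S.lt s(b, c) s(b₁, c') → rk c < rk c')
    (hR' : ∀ c c' : C, S.lt s(b₁, c) s(b, c') → rk' c' < rk' c)
    {n : ℕ} {d : N} (h : S.Far C ψ b rk rk' n d) : ∃ d', S.Far C ψ b rk rk' (n + 1) d' := by
  -- `f` places a copy of `C ∪ {b, b₁}` so that `b` goes to `d` and `b₁` to a new vertex
  let f : Option (Option C) → Option N := fun o => o.elim none fun o => some (adjoin C d o)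
  have hf : f.Injective := by
    rintro (_ | x) (_ | y) hxy
    · rfl
    · cases hxy
    · cases hxy
    · exact congrArg some (adjoin_injective h.notMem (Option.some_injective N hxy))
  have hsome : Function.Injective (some : N → Option N) := Option.some_injective N
  have hinter : Set.range some ∩ Set.range f = Set.range (f ∘ some) := by
    ext v
    constructor
    · rintro ⟨⟨y, rfl⟩, ⟨_ | x, hx⟩⟩
      · cases hx
      · exact ⟨x, hx⟩
    · rintro ⟨x, rfl⟩
      exact ⟨⟨adjoin C d x, rfl⟩, ⟨some x, rfl⟩⟩
  have hagree : (S.comap (adjoin₂ C b b₁)).comap some = (S.map some hsome).comap (f ∘ some) := by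
    rw [comap_comap]
    change S.comap (adjoin C b) = (S.map some hsome).comap (some ∘ adjoin C d)
    rw [← comap_comap, comap_map, h.type_eq]
  obtain ⟨E, -, h1, h2, hET, hlt, hbelow, hlt', hbelow'⟩ :=
    exists_amalgam (supportedOn_map some hsome S) hf hinter hagree
  have hES : E.comap some = S :=
    (comap_eq_of_leOn h2 h1 fun x => ⟨x, rfl⟩).trans (comap_map hsome S)
  -- the relations of the amalgam on its two sides
  have Slt := (comap_eq_comap_iff.1 (hES.trans S.comap_id.symm)).1
  have Sbelow := (comap_eq_comap_iff.1 (hES.trans S.comap_id.symm)).2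
  have Tlt := (comap_eq_comap_iff.1 hET).1
  have Tbelow := (comap_eq_comap_iff.1 hET).2
  have none_notMem : (none : Option N) ∉ Set.range (some : N → Option N) := by simp
  have b_notMem : some b ∉ Set.range f := by
    rintro ⟨_ | _ | c, hc⟩
    · cases hc
    · exact h.ne (hsome hc).symm
    · exact hb (by rw [← show c.1 = b from hsome hc]; exact c.2)
  -- the edges of the intersection are those in `C`, and those from `d` to `C`
  have inter_cases : ∀ g : Sym2 (Option N), Within g (Set.range some ∩ Set.range f) →
      ¬ g.IsDiag → (∃ c₁ c₂ : C, g = s(some c₁.1, some c₂.1)) ∨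
        ∃ c₁ : C, g = s(some d, some c₁.1) := by
    intro g hg hd
    rw [hinter] at hg
    induction g using Sym2.ind with
    | _ x y =>
      obtain ⟨⟨x, rfl⟩, ⟨y, rfl⟩⟩ := within_mk.1 hg
      rcases x with _ | c₁ <;> rcases y with _ | c₂
      · exact (hd (by simp)).elim
      · exact Or.inr ⟨c₂, rfl⟩
      · exact Or.inr ⟨c₁, Sym2.eq_swap⟩
      · exact Or.inl ⟨c₁, c₂, rfl⟩
  have F1 : ∀ c c' : C, E.lt s(some b, some c.1) s(none, some c'.1) → n + 1 ≤ rk c' := by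
    intro c c' hl
    rcases hlt _ _ hl with ⟨-, hw⟩ | ⟨hw, -⟩ | ⟨g, hg, hl1, hl2⟩
    · exact (none_notMem (within_mk.1 hw).1).elim
    · exact (b_notMem (within_mk.1 hw).1).elim
    rcases inter_cases g hg (E.lt_right hl1) with ⟨c₁, c₂, rfl⟩ | ⟨c₁, rfl⟩
    · have e1 := (Slt b c c₁ c₂).1 hl1
      have e2 := (Tlt (some (some c₁)) (some (some c₂)) none (some (some c'))).1 hl2
      exact (S.lt_disjoint (S.trans e1 ((type_lt_right htype c' c₁ c₂).2 e2))
        (Sym2.mem_mk_left b _) (Sym2.mem_mk_left b _)).elim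
    · have e1 := h.lt_up c c₁ ((Slt b c d c₁).1 hl1)
      have e2 := hR c₁ c' ((Tlt (some none) (some (some c₁)) none (some (some c'))).1 hl2)
      omega
  have F2 : ∀ c c' : C, E.lt s(none, some c.1) s(some b, some c'.1) → n + 1 ≤ rk' c := by
    intro c c' hl
    rcases hlt _ _ hl with ⟨hw, -⟩ | ⟨-, hw⟩ | ⟨g, hg, hl1, hl2⟩
    · exact (none_notMem (within_mk.1 hw).1).elim
    · exact (b_notMem (within_mk.1 hw).1).elim
    rcases inter_cases g hg (E.lt_right hl1) with ⟨c₁, c₂, rfl⟩ | ⟨c₁, rfl⟩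
    · have e1 := (Tlt none (some (some c)) (some (some c₁)) (some (some c₂))).1 hl1
      have e2 := (Slt c₁ c₂ b c').1 hl2
      exact (S.lt_disjoint (S.trans ((type_lt_left htype c c₁ c₂).2 e1) e2)
        (Sym2.mem_mk_left b _) (Sym2.mem_mk_left b _)).elim
    · have e1 := hR' c c₁ ((Tlt none (some (some c)) (some none) (some (some c₁))).1 hl1)
      have e2 := h.lt_down c₁ c' ((Slt d c₁ b c').1 hl2)
      omega
  have F3 : ∀ c : C, E.below (some b) s(none, some c.1) → n + 1 ≤ rk' c + 1 := by
    intro c hl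
    rcases hbelow _ _ hl with ⟨-, hw⟩ | ⟨hw, -⟩ | ⟨g, hg, hl1, hl2⟩
    · exact (none_notMem (within_mk.1 hw).1).elim
    · exact (b_notMem hw).elim
    rcases inter_cases g hg (E.lt_right hl1) with ⟨c₁, c₂, rfl⟩ | ⟨c₁, rfl⟩
    · have e1 := (Tlt none (some (some c)) (some (some c₁)) (some (some c₂))).1 hl1
      have e2 := (Sbelow b c₁ c₂).1 hl2
      exact (S.below_notMem (S.below_of_lt ((type_lt_left htype c c₁ c₂).2 e1) (Or.inr e2))
        (Sym2.mem_mk_left b _)).elim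
    · have e1 := hR' c c₁ ((Tlt none (some (some c)) (some none) (some (some c₁))).1 hl1)
      have e2 := h.below_left c₁ ((Sbelow b d c₁).1 hl2)
      omega
  have F4 : ∀ c : C, E.below none s(some b, some c.1) → n + 1 ≤ Nat.card C + 1 := by
    intro c hl
    rcases hbelow _ _ hl with ⟨hw, -⟩ | ⟨-, hw⟩ | ⟨g, hg, hl1, hl2⟩
    · exact (none_notMem hw).elim
    · exact (b_notMem (within_mk.1 hw).1).elim
    rcases inter_cases g hg (E.lt_right hl1) with ⟨c₁, c₂, rfl⟩ | ⟨c₁, rfl⟩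
    · have e1 := (Slt b c c₁ c₂).1 hl1
      have e2 := (Tbelow none (some (some c₁)) (some (some c₂))).1 hl2
      exact (S.below_notMem (S.below_of_lt e1 (Or.inr ((type_below htype c₁ c₂).2 e2)))
        (Sym2.mem_mk_left b _)).elim
    · have e1 := h.lt_up c c₁ ((Slt b c d c₁).1 hl1)
      have := hrk c₁
      omega
  have Fedge : ¬ (Within s(some b, none) (Set.range some) ∨ Within s(some b, none) (Set.range f)) :=
    not_or.2 ⟨fun hw => none_notMem (within_mk.1 hw).2, fun hw => b_notMem (within_mk.1 hw).1⟩
  -- the new vertex of the amalgam is realized over `C ∪ {b, d}` by some `d'`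
  obtain ⟨d', hd'⟩ := hS.exists_realize hES ((hC.insert d).insert b)
  have mC : ∀ c : C, (c.1, some c.1) ∈ insert (d', none) ((fun c => (c, some c)) ''
      insert b (insert d C)) := fun c => Or.inr ⟨c.1, Or.inr (Or.inr c.2), rfl⟩
  have mb : (b, some b) ∈ insert (d', none) ((fun c => (c, some c)) ''
      insert b (insert d C)) := Or.inr ⟨b, Or.inl rfl, rfl⟩
  have md : (d, some d) ∈ insert (d', none) ((fun c => (c, some c)) ''
      insert b (insert d C)) := Or.inr ⟨d, Or.inr (Or.inl rfl), rfl⟩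
  have md' : (d', none) ∈ insert (d', none) ((fun c => (c, some c)) ''
      insert b (insert d C)) := Or.inl rfl
  have mw : ∀ w, (adjoin₂ C d d' w, f w) ∈ insert (d', none) ((fun c => (c, some c)) ''
      insert b (insert d C)) := by
    rintro (_ | _ | c)
    exacts [md', md, mC c]
  have hpair : S.comap (adjoin₂ C b b₁) = S.comap (adjoin₂ C d d') := by
    rw [← hET]
    exact (comap_eq_comap_iff.2 ⟨fun i j k l => hd'.lt (mw i) (mw j) (mw k) (mw l),
      fun i j k => hd'.below (mw i) (mw j) (mw k)⟩).symm
  have hne : ∀ {x}, (x, some x) ∈ insert (d', none) ((fun c => (c, some c)) ''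
      insert b (insert d C)) → x ≠ d' := by
    intro x hx hxd
    exact Option.some_ne_none x ((hd'.eq hx md').1 hxd)
  have hd'C : d' ∉ C := fun hc => hne (mC ⟨d', hc⟩) rfl
  refine ⟨d', hne mb, hd'C, ?_, ?_, ?_, ?_, ?_, ?_, ?_, ?_, ?_⟩
  · have := congrArg (comap fun o : Option C => o.elim none fun c => some (some c)) hpair
    rw [comap_comap, comap_comap] at this
    have hcomp : ∀ x y, adjoin₂ C x y ∘ (fun o : Option C => o.elim none fun c => some (some c)) =
        adjoin C y := by
      intro x y
      funext o
      rcases o with _ | c <;> rfl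
    rw [hcomp, hcomp] at this
    exact htype.trans this
  · exact htr _ _ _ h.rel (hinv b b₁ d d' (adjoin₂_injective hb hb₁ hbb₁)
      (adjoin₂_injective h.notMem hd'C (hne md)) hpair hψ)
  · exact fun c c' hl => F1 c c' ((hd'.lt mb (mC c) md' (mC c')).1 hl)
  · exact fun c c' hl => F2 c c' ((hd'.lt md' (mC c) mb (mC c')).1 hl)
  · exact fun c hl => F3 c ((hd'.below mb md' (mC c)).1 hl)
  · exact fun c hl => F4 c ((hd'.below md' mb (mC c)).1 hl)
  · exact fun c c' hl => (Fedge (hlt' _ _ ((hd'.lt mb md' (mC c) (mC c')).1 hl)).1).elim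
  · exact fun c c' hl => (Fedge (hlt' _ _ ((hd'.lt (mC c) (mC c') mb md').1 hl)).2).elim
  · exact fun c hl => (Fedge (hbelow' _ _ ((hd'.below (mC c) mb md').1 hl))).elim

/-- In a generic sided switchboard, a strict partial order on vertices that is invariant under
partial isomorphisms fixing a finite set has no infinite ascending chain. -/
theorem IsGeneric.not_chain (hS : S.IsGeneric) (hC : C.Finite) {ψ : N → N → Prop}
    (hirr : ∀ x, ¬ ψ x x) (htr : ∀ x y z, ψ x y → ψ y z → ψ x z)
    (hinv : ∀ d e d' e', (adjoin₂ C d e).Injective → (adjoin₂ C d' e').Injective →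
      S.comap (adjoin₂ C d e) = S.comap (adjoin₂ C d' e') → ψ d e → ψ d' e')
    (b : ℕ → N) (hb : ∀ i j, i < j → ψ (b i) (b j)) : False := by
  have := hC.to_subtype
  obtain ⟨i, j, k, hij, hjk, h1, h2⟩ := exists_homogeneous_triple fun i j =>
    ((fun w w' => adjoin₂ C (b i) (b j) w = adjoin₂ C (b i) (b j) w'),
      S.comap (adjoin₂ C (b i) (b j)))
  obtain ⟨h1e, h1c⟩ := Prod.ext_iff.1 h1
  obtain ⟨h2e, h2c⟩ := Prod.ext_iff.1 h2
  have lt1 := (comap_eq_comap_iff.1 h1c).1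
  have lt2 := (comap_eq_comap_iff.1 h2c).1
  have hψ := hb i j hij
  have hne : ∀ {x y}, ψ x y → x ≠ y := by
    rintro x _ h rfl
    exact hirr x h
  have hiC : b i ∉ C := by
    intro hc
    have : b j = b i := Eq.mp (show (b i = b i) = (b j = b i) from
      congrFun (congrFun h2e (some none)) (some (some ⟨b i, hc⟩))) rfl
    exact hne hψ this.symm
  have hjC : b j ∉ C := by
    intro hc
    have : b k = b j := Eq.mp (show (b j = b j) = (b k = b j) from
      congrFun (congrFun h2e none) (some (some ⟨b j, hc⟩))) rfl
    exact hne (hb j k hjk) this.symm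
  have htype : S.comap (adjoin C (b i)) = S.comap (adjoin C (b j)) := by
    have := congrArg (comap some) h2c
    rw [comap_comap, comap_comap] at this
    exact this
  -- homogeneity makes the relations `{bᵢ, c} < {bⱼ, c'}` and `{bⱼ, c} < {bᵢ, c'}` transitive
  obtain ⟨rk, hrk, hR⟩ := exists_rank (R := fun c c' : C => S.lt s(b i, c) s(b j, c'))
    (fun c h => S.lt_disjoint h (Sym2.mem_mk_right _ _) (Sym2.mem_mk_right _ _))
    (fun c c' c'' h h' => by
      have h3 := (lt2 (some none) (some (some c')) none (some (some c''))).1 h'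
      exact (lt1 (some none) (some (some c)) none (some (some c''))).2 (S.trans h h3))
  obtain ⟨rk', hrk', hR'⟩ := exists_rank (R := fun c' c : C => S.lt s(b j, c) s(b i, c'))
    (fun c h => S.lt_disjoint h (Sym2.mem_mk_right _ _) (Sym2.mem_mk_right _ _))
    (fun c'' c' c h' h => by
      have h3 := (lt2 none (some (some c)) (some none) (some (some c'))).1 h
      exact (lt1 none (some (some c)) (some none) (some (some c''))).2 (S.trans h3 h'))
  have far : ∀ n, ∃ d, S.Far C ψ (b i) rk rk' (n + 1) d := by
    intro n
    induction n with
    | zero =>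
      refine ⟨b j, hne hψ, hjC, htype, hψ, fun c c' h => ?_, fun c c' h => ?_, ?_, ?_, ?_, ?_, ?_⟩
      · have := hR c c' h
        omega
      · have := hR' c' c h
        omega
      all_goals intros; omega
    | succ n ih =>
      obtain ⟨d, hd⟩ := ih
      exact hd.exists_succ hS hC htr hinv hiC hjC (hne hψ) hψ htype hrk hR (fun c c' => hR' c' c)
  obtain ⟨d, hd⟩ := far (Nat.card C + 1)
  have hswap := hd.swap hrk hrk' le_rfl
  exact hirr _ (htr _ _ _ hd.rel (hinv _ _ _ _ (adjoin₂_injective hiC hd.notMem hd.ne)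
    (adjoin₂_injective hd.notMem hiC hd.ne.symm) hswap hd.rel))

end

end Sided

/-! ### Formulas with a single parameter variable -/

theorem model_genericTheory_of_elementaryDiagram (M : Theory.ModelType.{0, 0, w} genericTheory)
    (N : Type w) [Lsw[[M]].Structure N] [Lsw.Structure N]
    [(lhomWithConstants Lsw M).IsExpansionOn N] (hN : N ⊨ Lsw.elementaryDiagram M) :
    N ⊨ genericTheory := by
  rw [Theory.model_iff]
  intro φ hφ
  rw [← LHom.realize_onSentence N (lhomWithConstants Lsw M) φ]
  refine (Theory.model_iff _).1 hN _ ?_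
  change M ⊨ (lhomWithConstants Lsw M).onSentence φ
  rw [LHom.realize_onSentence]
  exact (Theory.model_iff _).1 M.is_model φ hφ

theorem not_paramFormulaHasSOP (M : Theory.ModelType.{0, 0, w} genericTheory) (m : ℕ)
    (φ : (Lsw[[M]]).Formula (Fin m ⊕ Fin 1)) : ¬ ParamFormulaHasSOP M φ := by
  rintro ⟨N, b, hb⟩
  let _ : Lsw.Structure N := (lhomWithConstants Lsw M).reduct N
  obtain ⟨S, hS, hG⟩ := model_genericTheory_iff.1
    (model_genericTheory_of_elementaryDiagram M N N.is_model)
  obtain ⟨s, hs, hφ⟩ := exists_finite_realize_iff (BoundedFormula.constantsVarsEquiv φ)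
  let val (a : Fin m → N) (d : N) : M ⊕ (Fin m ⊕ Fin 1) → N :=
    Sum.elim (fun c => ((Lsw.con c : (Lsw[[M]]).Constants) : N)) (Sum.elim a fun _ => d)
  let sol (d : N) : Set (Fin m → N) := solutionSet N φ fun _ => d
  have mem_sol : ∀ a d, a ∈ sol d ↔
      Formula.Realize (BoundedFormula.constantsVarsEquiv φ) (val a d) := fun a d =>
    BoundedFormula.realize_constantsVarsEquiv.symm
  -- the interpretations of the constants that occur in `φ`
  let C : Set N := (fun c => ((Lsw.con c : (Lsw[[M]]).Constants) : N)) '' (Sum.inl ⁻¹' s)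
  have hC : C.Finite := (hs.preimage Sum.inl_injective.injOn).image _
  -- inclusion between solution sets is invariant under partial isomorphisms fixing `C`
  have sub : ∀ r : Set (N × N), r.Finite → S.PartialIso S r → (∀ c ∈ C, (c, c) ∈ r) →
      ∀ d e d' e', (d, d') ∈ r → (e, e') ∈ r → sol d ⊆ sol e → sol d' ⊆ sol e' := by
    intro r hr h hCr d e d' e' hd he hsub a' ha'
    obtain ⟨r', hrr', hr', h', hdom⟩ := hG.exists_extend
      (hr.preimage Prod.swap_injective.injOn) h.symm (Set.finite_range a')
    choose a ha using fun i => hdom (a' i) ⟨i, rfl⟩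
    have realize : ∀ x x', (x', x) ∈ r' → (a' ∈ sol x' ↔ a ∈ sol x) := by
      intro x x' hx
      rw [mem_sol, mem_sol]
      refine hφ hS hS hG hG (h'.mono ?_)
      rintro _ (⟨c | i | i, hc, rfl⟩ | ⟨i, rfl⟩)
      · exact hrr' (hCr _ ⟨c, hc, rfl⟩)
      · exact ha i
      · exact hx
      · exact i.elim0
    exact (realize e e' (hrr' he)).2 (hsub ((realize d d' (hrr' hd)).1 ha'))
  refine hG.not_chain hC (ψ := fun d e => sol d ⊂ sol e) (fun x => ssubset_irrefl _)
    (fun x y z => ssubset_trans) ?_ (fun i => b i 0) ?_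
  · intro d e d' e' hi hi' heq hψ
    have hiso : S.PartialIso S
        (Set.range fun i => (Sided.adjoin₂ C d e i, Sided.adjoin₂ C d' e' i)) :=
      Sided.partialIso_range.2 ⟨fun i j => by rw [hi.eq_iff, hi'.eq_iff], heq⟩
    have := hC.to_subtype
    have hfin := Set.finite_range fun i => (Sided.adjoin₂ C d e i, Sided.adjoin₂ C d' e' i)
    refine ⟨sub _ hfin hiso (fun c hc => ⟨some (some ⟨c, hc⟩), rfl⟩) d e d' e' ⟨some none, rfl⟩
      ⟨none, rfl⟩ hψ.1, fun hn => hψ.2 ?_⟩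
    exact sub _ (hfin.preimage Prod.swap_injective.injOn) hiso.symm
      (fun c hc => ⟨some (some ⟨c, hc⟩), rfl⟩) e' d' e d ⟨none, rfl⟩ ⟨some none, rfl⟩ hn
  · have hb' : ∀ i, (fun _ => b i 0) = b i := fun i => funext fun j => by
      rw [Subsingleton.elim j 0]
    have : StrictMono fun i => sol (b i 0) := strictMono_nat_of_lt_succ fun i => by
      change solutionSet N φ (fun _ => b i 0) ⊂ solutionSet N φ (fun _ => b (i + 1) 0)
      rw [hb', hb']
      exact hb i
    exact fun i j hij => this hij

end Switchboards

theorem mainTheorem1 :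
    ∃ T : Switchboards.Lsw.Theory,
      Switchboards.IsModelCompanion.{0, 0, w} Switchboards.switchboardTheory T ∧
      T.IsComplete ∧
      Cardinal.Categorical Cardinal.aleph0.{w} T ∧
      Switchboards.HasSOP.{0, 0, w} T ∧
      ∀ (M : FirstOrder.Language.Theory.ModelType.{0, 0, w} T) (m : ℕ)
        (φ : (Switchboards.Lsw[[M]]).Formula (Fin m ⊕ Fin 1)),
        ¬ Switchboards.ParamFormulaHasSOP M φ :=
  ⟨Switchboards.genericTheory, Switchboards.isModelCompanion_genericTheory,
    Switchboards.isComplete_genericTheory, Switchboards.categorical_genericTheory,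
    Switchboards.hasSOP_genericTheory, Switchboards.not_paramFormulaHasSOP⟩
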